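/- All pairs $(X,Y)$, $(U,V)$, $(A,B)$ below take finitely many values, and logarithms are to base 2. (Internal states, messages and views of protocols take values in arbitrary discrete alphabets.) For a pair $(X,Y)$ of jointly distributed random variables, the \emph{region of tension} $\mathfrak R(X;Y)\subseteq\mathbb R_{\ge 0}^3$ is the set of all $s\in\mathbb R_{\ge0}^3$ such that, for some random variable $Q$ with a finite alphabet, jointly distributed with $(X,Y)$ (i.e. some conditional distribution $p_{Q|XY}$), $s\ge\big(I(Y;Q|X),\,I(X;Q|Y),\,I(X;Y|Q)\big)$ coordinatewise. A \emph{two-party protocol} starts with Alice holding $X$ and Bob holding $Y$ (the set up). Alice and Bob alternately take turns, Alice first; on its turn a party applies a randomized function (with private randomness) to what it has seen so far, and obtains a new internal state together with either a message for the other party or a final output, with which it terminates. The \emph{view} of a party consists of its part of the set up, the sequence of its internal states, its output, and all messages it sent or received (including the notification that the other party has terminated). The protocol is \emph{valid} if with probability 1 both parties terminate after finitely many rounds. A valid protocol with final views $\Pi^{\rm view}_A,\Pi^{\rm view}_B$ and outputs $\Pi^{\rm out}_A,\Pi^{\rm out}_B$ \emph{$\epsilon$-securely samples} $(U,V)$ from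 $(X,Y)$ if there are random variables $\Sigma_A,\Sigma_B$ jointly distributed with $(U,V)$, with values in the alphabets of the views, such that $\Sigma_A - U - V$ and $U - V - \Sigma_B$ are Markov chains and the total variation distance between $(U,V)$ and $(\Pi^{\rm out}_A,\Pi^{\rm out}_B)$, between $(\Sigma_A,V)$ and $(\Pi^{\rm view}_A,\Pi^{\rm out}_B)$, and between $(U,\Sigma_B)$ and $(\Pi^{\rm out}_A,\Pi^{\rm view}_B)$, is at most $\epsilon$ in each case. Writing $(X^n,Y^n)$ for $n$ independent copies of $(X,Y)$, $(U,V)$ can be \emph{statistically securely sampled} from $(X,Y)$ if for every $\epsilon>0$ there are integers $n_1,n_2\ge1$ and a protocol that $\epsilon$-securely samples $(U^{n_1},V^{n_1})$ from $(X^{n_2},Y^{n_2})$; the \emph{rate} of doing so is $$\lim_{\epsilon\downarrow0}\ \sup\Big\{\tfrac{n_1}{n_2}: n_1,n_2\ge 1,\ \text{some protocol } \epsilon\text{-securely samples } (U^{n_1},V^{n_1})\text{ from }(X^{n_2},Y^{n_2})\Big\}.$$ Let $L\ge1$, let $S_{A,1},S_{A,2},S_{B,1},S_{B,2}\in\{0,1\}^L$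 and $C_A,C_B\in\{1,2\}$ be independent and uniform, and let $X=(C_A,S_{A,1},S_{A,2},S_{B,C_A})$, $Y=(C_B,S_{B,1},S_{B,2},S_{A,C_B})$ (two $L$-bit string-OTs, one in each direction). Let $(U,V)$ be distributed as $(X,Y)$ with $L=1$ (two bit-OTs in opposite directions). Let $(A,B)$ be a single bit-OT: $A=(S_1,S_2)$, $B=(C,S_C)$ with $S_1,S_2\in\{0,1\}$ and $C\in\{1,2\}$ independent and uniform. \textbf{Theorem.} \begin{enumerate} \item For every $L\ge1$, $(U,V)$ can be statistically securely sampled from $(X,Y)$, and the rate (a limit in $[0,\infty]$) exists and equals $1$. \item $(1,1,0)$ belongs to $\mathfrak R(U;V)$ and lies on its boundary; moreover $(1,1)$ lies on the boundary in $\mathbb R^2$ of the slice $\{(R_1,R_2):(R_1,R_2,0)\in\mathfrak R(U;V)\}$, and $\min\{R_1+R_2:(R_1,R_2,0)\in\mathfrak R(U;V)\}=2$. \item $\min\{R_1+R_2:(R_1,R_2,0)\in\mathfrak R(A;B)\}=1$. \end{enumerate} -/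

import Mathlib

open scoped ENNReal

/-! ### Finite information theory (logarithms to base 2) -/

/-- Shannon entropy, in bits, of a distribution on a finite alphabet. -/
noncomputable def shannonEntropy {α : Type} [Fintype α] (p : PMF α) : ℝ :=
  ∑ a, (p a).toReal * Real.logb 2 (1 / (p a).toReal)

/-- Conditional mutual information `I(F;G|K) = H(F,K) + H(G,K) - H(F,G,K) - H(K)` of the
random variables `F`, `G`, `K` on the probability space `(Ω, p)`. -/
noncomputable def condMutualInfo {Ω α β γ : Type} [Fintype α] [Fintype β] [Fintype γ]
    (p : PMF Ω) (F : Ω → α) (G : Ω → β) (K : Ω → γ) : ℝ :=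
  shannonEntropy (p.map fun ω => (F ω, K ω)) + shannonEntropy (p.map fun ω => (G ω, K ω))
    - shannonEntropy (p.map fun ω => (F ω, G ω, K ω)) - shannonEntropy (p.map K)

/-- Total variation distance `½ ‖p - q‖₁` of two discrete distributions. -/
noncomputable def tvDist {α : Type} (p q : PMF α) : ℝ :=
  (1 / 2) * ∑' a, |(p a).toReal - (q a).toReal|

/-! ### The region of tension -/

/-- The joint law of `((X, Y), Q)`, for `(X, Y)` with law `p` and `Q` with conditional law
`κ (x, y)` given `(X, Y) = (x, y)`. -/
noncomputable def jointWith {X Y Q : Type} (p : PMF (X × Y)) (κ : X × Y → PMF Q) :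
    PMF ((X × Y) × Q) :=
  p.bind fun xy => (κ xy).map fun z => (xy, z)

/-- The tension `(I(Y;Q|X), I(X;Q|Y), I(X;Y|Q))` of `(X, Y)` given `Q`. -/
noncomputable def tension {X Y Q : Type} [Fintype X] [Fintype Y] [Fintype Q]
    (p : PMF (X × Y)) (κ : X × Y → PMF Q) : ℝ × ℝ × ℝ :=
  (condMutualInfo (jointWith p κ) (fun ω => ω.1.2) (fun ω => ω.2) (fun ω => ω.1.1),
   condMutualInfo (jointWith p κ) (fun ω => ω.1.1) (fun ω => ω.2) (fun ω => ω.1.2),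
   condMutualInfo (jointWith p κ) (fun ω => ω.1.1) (fun ω => ω.1.2) (fun ω => ω.2))

/-- The increasing hull, inside the nonnegative orthant of `ℝ³`, of a set. -/
def increasingHull (S : Set (ℝ × ℝ × ℝ)) : Set (ℝ × ℝ × ℝ) :=
  {s | 0 ≤ s ∧ ∃ s' ∈ S, s' ≤ s}

/-- The region of tension of a pair with law `p`: the increasing hull of the tensions over all
conditional distributions of a random variable `Q` with an arbitrary finite alphabet. -/
noncomputable def tensionRegion {X Y : Type} [Fintype X] [Fintype Y] (p : PMF (X × Y)) :
    Set (ℝ × ℝ × ℝ) :=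
  increasingHull {t | ∃ (k : ℕ) (κ : X × Y → PMF (Fin k)), t = tension p κ}

/-! ### Two-party protocols -/

/-- One entry in the record that a party keeps of an execution. -/
inductive Event (W M O : Type) : Type
  /-- The party moved: it chose the new internal state `w` and either sent a message or
  terminated with an output. -/
  | act (w : W) (r : M ⊕ O)
  /-- The other party moved: it sent a message, or (`none`) it terminated. -/
  | recv (m : Option M)

/-- The view of a party: its part of the set up together with the record of all its internal
states and of all messages it sent and received, latest event first. -/
structure View (X W M O : Type) : Type where
  input : X
  events : List (Event W M O)

/-- The output carried by an event, if any. -/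
def Event.output {W M O : Type} : Event W M O → Option O
  | .act _ (.inr o) => some o
  | _ => none

/-- The output of a party, if it has terminated; a function of its view. -/
def View.output {X W M O : Type} (v : View X W M O) : Option O :=
  v.events.findSome? Event.output

/-- Add an event to a view. -/
def View.add {X W M O : Type} (v : View X W M O) (e : Event W M O) : View X W M O :=
  ⟨v.input, e :: v.events⟩

/-- A party that has not terminated records that the other party sent a message or terminated. -/
def View.receive {X W M O : Type} (v : View X W M O) (m : Option M) : View X W M O :=
  if v.output.isSome then v else v.add (.recv m)

/-- One turn of a party with randomized strategy `π` and view `v`, the other party having view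
`v'`. A party that has terminated does nothing. -/
noncomputable def takeTurn {X Y W W' M O O' : Type} (π : View X W M O → PMF (W × (M ⊕ O)))
    (v : View X W M O) (v' : View Y W' M O') : PMF (View X W M O × View Y W' M O') :=
  if v.output.isSome then PMF.pure (v, v')
  else (π v).map fun s => (v.add (.act s.1 s.2), v'.receive s.2.getLeft?)

/-- A two-party protocol with set up in `X × Y` and outputs in `U × V`. Each strategy is
randomized with private randomness; it maps what the party has seen to a new internal state and
either a message for the other party or a final output. -/
structure Protocol (X Y U V : Type) : Type 1 where
  StateA : Type
  StateB : Type
  Msg : Type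
  alice : View X StateA Msg U → PMF (StateA × (Msg ⊕ U))
  bob : View Y StateB Msg V → PMF (StateB × (Msg ⊕ V))

namespace Protocol

variable {X Y U V : Type}

/-- Alice's views. -/
abbrev ViewA (P : Protocol X Y U V) : Type := View X P.StateA P.Msg U

/-- Bob's views. -/
abbrev ViewB (P : Protocol X Y U V) : Type := View Y P.StateB P.Msg V

/-- One round: Alice takes a turn, then Bob takes a turn. -/
noncomputable def round (P : Protocol X Y U V) (c : P.ViewA × P.ViewB) :
    PMF (P.ViewA × P.ViewB) :=
  (takeTurn P.alice c.1 c.2).bind fun d => (takeTurn P.bob d.2 d.1).map Prod.swap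

/-- The joint law of the views after `n` rounds, with set up of law `p`. -/
noncomputable def run (P : Protocol X Y U V) (p : PMF (X × Y)) : ℕ → PMF (P.ViewA × P.ViewB)
  | 0 => p.map fun xy => (⟨xy.1, []⟩, ⟨xy.2, []⟩)
  | n + 1 => (run P p n).bind P.round

/-- Both parties have terminated. -/
def Halted (P : Protocol X Y U V) (c : P.ViewA × P.ViewB) : Prop :=
  c.1.output.isSome ∧ c.2.output.isSome

open Classical in
/-- The probability that the execution terminates with final views `c`. Since views no longer
change once both parties have terminated, the supremum is that of a nondecreasing sequence. -/
noncomputable def finalMass (P : Protocol X Y U V) (p : PMF (X × Y)) (c : P.ViewA × P.ViewB) :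
    ℝ≥0∞ :=
  ⨆ n, if P.Halted c then P.run p n c else 0

/-- The protocol is valid: with probability 1 both parties terminate after finitely many
rounds. -/
def Valid (P : Protocol X Y U V) (p : PMF (X × Y)) : Prop :=
  ∑' c, P.finalMass p c = 1

/-- The joint law of the final views of a valid protocol. -/
noncomputable def finalViews (P : Protocol X Y U V) (p : PMF (X × Y)) (h : P.Valid p) :
    PMF (P.ViewA × P.ViewB) :=
  ⟨P.finalMass p, by
    have h' : ∑' c, P.finalMass p c = 1 := h
    have h'' : Summable (P.finalMass p) := ENNReal.summable
    exact h' ▸ h''.hasSum⟩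

/-- `P` is valid and `ε`-securely samples a pair of law `q` using a pair of law `p` as set up.
The simulated view of Alice is generated from `U` alone and that of Bob from `V` alone, so that
`Σ_A - U - V` and `U - V - Σ_B` are Markov chains. The outputs of a valid protocol are almost
surely of the form `some _`. -/
def SecurelySamples (P : Protocol X Y U V) (ε : ℝ) (p : PMF (X × Y)) (q : PMF (U × V)) : Prop :=
  ∃ (h : P.Valid p) (simA : U → PMF P.ViewA) (simB : V → PMF P.ViewB),
    tvDist (q.map fun uv => (some uv.1, some uv.2))
      ((P.finalViews p h).map fun c => (c.1.output, c.2.output)) ≤ ε ∧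
    tvDist (q.bind fun uv => (simA uv.1).map fun s => (s, some uv.2))
      ((P.finalViews p h).map fun c => (c.1, c.2.output)) ≤ ε ∧
    tvDist (q.bind fun uv => (simB uv.2).map fun s => (some uv.1, s))
      ((P.finalViews p h).map fun c => (c.1.output, c.2)) ≤ ε

end Protocol

/-! ### Independent copies and the rate of secure sampling -/

/-- The law of `n` independent samples from `p`. -/
noncomputable def iidPMF {α : Type} [Fintype α] (p : PMF α) (n : ℕ) : PMF (Fin n → α) :=
  PMF.ofFintype (fun f => ∏ i, p (f i)) (by
    classical
    have h := Finset.prod_univ_sum (fun _ : Fin n => (Finset.univ : Finset α)) (fun _ a => p a)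
    rw [Fintype.piFinset_univ] at h
    rw [← h]
    have hp : ∑ a, p a = 1 := (tsum_fintype (fun a => p a)).symm.trans p.tsum_coe
    simp [hp])

/-- The law of `(Xⁿ, Yⁿ)`, that is, of `n` independent copies of a pair `(X, Y)` of law `p`. -/
noncomputable def copies {X Y : Type} [Fintype X] [Fintype Y] (p : PMF (X × Y)) (n : ℕ) :
    PMF ((Fin n → X) × (Fin n → Y)) :=
  (iidPMF p n).map fun f => (fun i => (f i).1, fun i => (f i).2)

/-- `n₁` copies of a pair of law `q` can be `ε`-securely sampled from `n₂` copies of a pair of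
law `p`, by some protocol. -/
def CanSample {X Y U V : Type} [Fintype X] [Fintype Y] [Fintype U] [Fintype V]
    (p : PMF (X × Y)) (q : PMF (U × V)) (ε : ℝ) (n₁ n₂ : ℕ) : Prop :=
  ∃ P : Protocol (Fin n₂ → X) (Fin n₂ → Y) (Fin n₁ → U) (Fin n₁ → V),
    P.SecurelySamples ε (copies p n₂) (copies q n₁)

/-- A pair of law `q` can be statistically securely sampled from a pair of law `p`. -/
def StatSecurelySampleable {X Y U V : Type} [Fintype X] [Fintype Y] [Fintype U] [Fintype V]
    (p : PMF (X × Y)) (q : PMF (U × V)) : Prop :=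
  ∀ ε : ℝ, 0 < ε → ∃ n₁ n₂ : ℕ, 0 < n₁ ∧ 0 < n₂ ∧ CanSample p q ε n₁ n₂

/-- The supremum of the ratios `n₁ / n₂` that are achievable with error `ε`. -/
noncomputable def epsRate {X Y U V : Type} [Fintype X] [Fintype Y] [Fintype U] [Fintype V]
    (p : PMF (X × Y)) (q : PMF (U × V)) (ε : ℝ) : ℝ≥0∞ :=
  sSup {r | ∃ n₁ n₂ : ℕ, 0 < n₁ ∧ 0 < n₂ ∧ CanSample p q ε n₁ n₂ ∧
    r = (n₁ : ℝ≥0∞) / (n₂ : ℝ≥0∞)}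

/-- `r` is the rate of statistically securely sampling a pair of law `q` from a pair of law `p`:
the limit, as the error `ε` decreases to `0`, of the rate achievable with error `ε`. -/
def IsStatSamplingRate {X Y U V : Type} [Fintype X] [Fintype Y] [Fintype U] [Fintype V]
    (p : PMF (X × Y)) (q : PMF (U × V)) (r : ℝ≥0∞) : Prop :=
  StatSecurelySampleable p q ∧
    Filter.Tendsto (epsRate p q) (nhdsWithin 0 (Set.Ioi 0)) (nhds r)

/-! ### Oblivious transfer -/

/-- `L`-bit strings. -/
abbrev BitString (L : ℕ) : Type := Fin L → Bool

/-- What a party holds in a pair of opposite string-OTs: its choice, its own two strings, and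
the string of the other party that it chose. -/
abbrev OTPairShare (L : ℕ) : Type := Fin 2 × (Fin 2 → BitString L) × BitString L

/-- The law of `(X, Y)` with `X = (C_A, S_A, S_{B,C_A})` and `Y = (C_B, S_B, S_{A,C_B})`, a pair
of `L`-bit string-OTs in opposite directions. The sample is `((C_A, C_B), (S_A, S_B))`. -/
noncomputable def otPair (L : ℕ) : PMF (OTPairShare L × OTPairShare L) :=
  (PMF.uniformOfFintype
      ((Fin 2 × Fin 2) × ((Fin 2 → BitString L) × (Fin 2 → BitString L)))).map
    fun ω => ((ω.1.1, ω.2.1, ω.2.2 ω.1.1), (ω.1.2, ω.2.2, ω.2.1 ω.1.2))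

/-- The law of a single bit-OT `(A, B)`, with `A = (S₁, S₂)` and `B = (C, S_C)`. -/
noncomputable def bitOT : PMF ((Fin 2 → Bool) × (Fin 2 × Bool)) :=
  (PMF.uniformOfFintype ((Fin 2 → Bool) × Fin 2)).map fun ω => (ω.1, (ω.2, ω.1 ω.2))

/-! The core is a fact about independent parties: if independent `(S₁, S₂)` and `(C, R)` always
satisfy `S_C = R`, one party is deterministic and the other holds at most one bit
(`ent_add_ent_le_of_otError_eq_zero`). Compactness makes this robust (`exists_ent_add_ent_le`). By
subadditivity, independent parties holding `n` nearly correct opposite OT pairs have total entropy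
barely above `2n` bits.

Converse for the rate. Let `Z` be the transcript together with all choices and received strings of
the set up. Given `Z` the two views are independent: each turn multiplies the law by a function of
one view (`Factors.takeTurn`), and the set up itself is a product once the choices and received
strings are fixed (`rankOneOn_commonA`). Hence `H(U|Z) + H(V|Z)` is about `2n₁` bits at most. But
`Z` is a function of one party's view and the other's `n₂` choice bits, so `H(V|Z) ≥ H(V|view_A) -
n₂`, and security makes `H(V|view_A)` nearly at least `H(V|U) = 2n₁`. The same holds for `U`. Adding
up, `4n₁ - 2n₂ ≤ 2n₁` up to small terms, that is, `n₁ ≤ n₂` in the limit. Views live in arbitrary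
alphabets, so conditional entropies are replaced by expected cross entropies with values in `ℝ≥0∞`,
taken against smoothed conditional laws. Smoothing bounds them, so that total variation controls
their change; see `le_expect_cross` and `CanSample.bound`.

Achievability. Longer strings are single bits with independent bits appended, so truncation without
communication is perfectly secure (`canSample_one_one`).

Tension. If `I(X;Y|Q) = 0`, then `I(Y;Q|X) + I(X;Q|Y) = 2H(X,Y) - H(X) - H(Y) - H(X,Y|Q)`. Given `Q`
the pair is independent, so the fact above bounds `H(X,Y|Q)` by 2 bits for the opposite pair and by
1 bit for a single OT (`le_tension_add`). Explicit choices of `Q` attain the resulting values 2 and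
1. Points with smaller coordinate sum approach `(1,1)`, which puts it on the boundary. -/

/-! ### Entropy of real vectors on finite alphabets -/

/-- The entropy, in nats, of a vector on a finite alphabet. -/
noncomputable def ent {U : Type} [Fintype U] (a : U → ℝ) : ℝ := ∑ u, Real.negMulLog (a u)

open Classical in
/-- The image of a vector under a map of alphabets. -/
noncomputable def marg {U T : Type} [Fintype U] (g : U → T) (a : U → ℝ) (t : T) : ℝ :=
  ∑ u, if g u = t then a u else 0

section Entropy

variable {U T : Type} [Fintype U] [Fintype T]

/-- This is `log x ≤ x - 1` at `x = r / a`, multiplied by `a`. Since `Real.log 0 = 0`, the case `r =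
0 < a` has to be excluded by `h`. -/
theorem negMulLog_le_cross {a r : ℝ} (ha : 0 ≤ a) (hr : 0 ≤ r) (h : a ≠ 0 → r ≠ 0) :
    Real.negMulLog a ≤ a * (-Real.log r) + r - a := by
  rcases eq_or_ne a 0 with rfl | h0
  · simpa using hr
  have ha' : 0 < a := lt_of_le_of_ne ha (Ne.symm h0)
  have hr' : 0 < r := lt_of_le_of_ne hr (Ne.symm (h h0))
  have h1 := Real.log_le_sub_one_of_pos (div_pos hr' ha')
  rw [Real.log_div hr'.ne' ha'.ne'] at h1
  have h2 := mul_le_mul_of_nonneg_left h1 ha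
  have h3 : a * (r / a - 1) = r - a := by field_simp
  rw [h3] at h2
  simp only [Real.negMulLog]
  linarith

/-- Gibbs' inequality. Neither vector needs to be normalised: the correction terms `r u - a u` sum
to at most zero. -/
theorem ent_le_cross {a r : U → ℝ} (ha : ∀ u, 0 ≤ a u) (hr : ∀ u, 0 ≤ r u)
    (h : ∀ u, a u ≠ 0 → r u ≠ 0) (hs : ∑ u, r u ≤ ∑ u, a u) :
    ent a ≤ ∑ u, a u * (-Real.log (r u)) := by
  have h1 : ent a ≤ ∑ u, (a u * (-Real.log (r u)) + r u - a u) :=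
    Finset.sum_le_sum fun u _ => negMulLog_le_cross (ha u) (hr u) (h u)
  rw [Finset.sum_sub_distrib, Finset.sum_add_distrib] at h1
  linarith

theorem ent_le_log_card {a : U → ℝ} (ha : a ∈ stdSimplex ℝ U) (s : Finset U)
    (h : ∀ u, a u ≠ 0 → u ∈ s) : ent a ≤ Real.log s.card := by
  classical
  have hne : s.Nonempty := by
    by_contra hs
    have : ∀ u, a u = 0 := fun u => by
      by_contra h0; exact hs ⟨u, h u h0⟩
    simpa [this] using ha.2
  have hc : (0 : ℝ) < s.card := by exact_mod_cast hne.card_pos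
  have h1 := ent_le_cross (r := fun u => if u ∈ s then (s.card : ℝ)⁻¹ else 0) ha.1
    (fun u => by split_ifs <;> positivity)
    (fun u hu => by simp [h u hu, hc.ne'])
    (by simp [Finset.sum_ite_mem, ha.2, hc.ne'])
  refine h1.trans_eq ?_
  have : ∀ u, a u * (-Real.log (if u ∈ s then (s.card : ℝ)⁻¹ else 0))
      = a u * Real.log s.card := fun u => by
    by_cases h0 : a u = 0
    · simp [h0]
    · simp [h u h0]
  rw [Finset.sum_congr rfl fun u _ => this u, ← Finset.sum_mul, ha.2, one_mul]

theorem sum_marg_mul (g : U → T) (a : U → ℝ) (f : T → ℝ) :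
    ∑ t, marg g a t * f t = ∑ u, a u * f (g u) := by
  classical
  simp only [marg, Finset.sum_mul]
  rw [Finset.sum_comm]
  refine Finset.sum_congr rfl fun u _ => ?_
  simp [ite_mul]

theorem marg_mem_stdSimplex (g : U → T) {a : U → ℝ} (ha : a ∈ stdSimplex ℝ U) :
    marg g a ∈ stdSimplex ℝ T := by
  classical
  refine ⟨fun t => Finset.sum_nonneg fun u _ => ?_, ?_⟩
  · split_ifs
    exacts [ha.1 u, le_rfl]
  · simpa [ha.2] using sum_marg_mul g a fun _ => 1

theorem le_marg {T' : Type} (g : U → T') {a : U → ℝ} (ha : ∀ u, 0 ≤ a u) (u : U) : a u ≤ marg g a (g u) := by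
  classical
  have := Finset.single_le_sum (s := Finset.univ) (f := fun v => if g v = g u then a v else 0)
    (fun v _ => by split_ifs; exacts [ha v, le_rfl]) (Finset.mem_univ u)
  simpa [marg] using this

theorem marg_ne_zero {T' : Type} (g : U → T') {a : U → ℝ} (ha : ∀ u, 0 ≤ a u) {u : U} (hu : a u ≠ 0) :
    marg g a (g u) ≠ 0 :=
  ((lt_of_le_of_ne (ha u) (Ne.symm hu)).trans_le (le_marg g ha u)).ne'

/-- Subadditivity of entropy, for finitely many maps that are jointly injective. -/
theorem ent_le_sum_marg {ι : Type} [Fintype ι] (g : ι → U → T)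
    (hg : Function.Injective fun u i => g i u) {a : U → ℝ} (ha : a ∈ stdSimplex ℝ U) :
    ent a ≤ ∑ i, ent (marg (g i) a) := by
  classical
  have hm := fun i => marg_mem_stdSimplex (g i) ha
  have hne : ∀ u, a u ≠ 0 → ∀ i, marg (g i) a (g i u) ≠ 0 := fun u hu i =>
    marg_ne_zero (g i) ha.1 hu
  -- The reference vector is the product of the marginals, pulled back along the joint map.
  -- Injectivity of that map keeps its total at most 1.
  have h1 := ent_le_cross (r := fun u => ∏ i, marg (g i) a (g i u)) ha.1
    (fun u => Finset.prod_nonneg fun i _ => (hm i).1 _)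
    (fun u hu => Finset.prod_ne_zero_iff.2 fun i _ => hne u hu i) (by
      calc ∑ u, ∏ i, marg (g i) a (g i u)
          = ∑ f ∈ Finset.univ.image (fun u i => g i u), ∏ i, marg (g i) a (f i) := by
            rw [Finset.sum_image fun x _ y _ h => hg h]
        _ ≤ ∑ f : ι → T, ∏ i, marg (g i) a (f i) :=
            Finset.sum_le_sum_of_subset_of_nonneg (Finset.subset_univ _)
              fun f _ _ => Finset.prod_nonneg fun i _ => (hm i).1 _
        _ = ∏ i, ∑ t, marg (g i) a t := by
            rw [Finset.prod_univ_sum, Fintype.piFinset_univ]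
        _ = 1 := Finset.prod_eq_one fun i _ => (hm i).2
        _ = ∑ u, a u := ha.2.symm)
  refine h1.trans_eq ?_
  have h2 : ∀ i, ent (marg (g i) a) = ∑ u, a u * (-Real.log (marg (g i) a (g i u))) := fun i => by
    rw [← sum_marg_mul (g i) a fun t => -Real.log (marg (g i) a t)]
    simp [ent, Real.negMulLog]
  simp_rw [h2]
  rw [Finset.sum_comm]
  refine Finset.sum_congr rfl fun u _ => ?_
  rw [← Finset.mul_sum]
  by_cases h0 : a u = 0
  · simp [h0]
  · rw [Real.log_prod fun i _ => hne u h0 i, Finset.sum_neg_distrib]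

/-- The same argument for two maps whose targets may be different types. -/
theorem ent_le_marg_add_marg {T' : Type} [Fintype T'] (g : U → T) (g' : U → T')
    (hg : Function.Injective fun u => (g u, g' u)) {a : U → ℝ} (ha : a ∈ stdSimplex ℝ U) :
    ent a ≤ ent (marg g a) + ent (marg g' a) := by
  classical
  have hm := marg_mem_stdSimplex g ha
  have hm' := marg_mem_stdSimplex g' ha
  have h1 := ent_le_cross (r := fun u => marg g a (g u) * marg g' a (g' u)) ha.1
    (fun u => mul_nonneg (hm.1 _) (hm'.1 _))
    (fun u hu => mul_ne_zero (marg_ne_zero g ha.1 hu) (marg_ne_zero g' ha.1 hu)) (by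
      calc ∑ u, marg g a (g u) * marg g' a (g' u)
          = ∑ f ∈ Finset.univ.image (fun u => (g u, g' u)), marg g a f.1 * marg g' a f.2 := by
            rw [Finset.sum_image fun x _ y _ h => hg h]
        _ ≤ ∑ f : T × T', marg g a f.1 * marg g' a f.2 :=
            Finset.sum_le_sum_of_subset_of_nonneg (Finset.subset_univ _)
              fun f _ _ => mul_nonneg (hm.1 _) (hm'.1 _)
        _ = (∑ t, marg g a t) * ∑ t, marg g' a t := by
            rw [Finset.sum_mul_sum, Fintype.sum_prod_type]
        _ = ∑ u, a u := by rw [hm.2, hm'.2, ha.2, one_mul])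
  refine h1.trans_eq ?_
  have h2 : ent (marg g a) = ∑ u, a u * (-Real.log (marg g a (g u))) := by
    rw [← sum_marg_mul g a fun t => -Real.log (marg g a t)]
    simp [ent, Real.negMulLog]
  have h3 : ent (marg g' a) = ∑ u, a u * (-Real.log (marg g' a (g' u))) := by
    rw [← sum_marg_mul g' a fun t => -Real.log (marg g' a t)]
    simp [ent, Real.negMulLog]
  rw [h2, h3, ← Finset.sum_add_distrib]
  refine Finset.sum_congr rfl fun u _ => ?_
  by_cases h0 : a u = 0
  · simp [h0]
  · rw [Real.log_mul (marg_ne_zero g ha.1 h0) (marg_ne_zero g' ha.1 h0)]; ring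

end Entropy

/-! ### Oblivious transfer held by independent parties -/

section OT

variable {T : Type} [Fintype T] [DecidableEq T]

/-- The probability that independent `A = (S₁, S₂)` and `B = (C, R)` have `S_C ≠ R`. -/
noncomputable def otError (a : (Fin 2 → T) → ℝ) (b : Fin 2 × T → ℝ) : ℝ :=
  ∑ x, ∑ y, if x y.1 ≠ y.2 then a x * b y else 0

theorem otError_nonneg {a : (Fin 2 → T) → ℝ} {b : Fin 2 × T → ℝ} (ha : ∀ x, 0 ≤ a x)
    (hb : ∀ y, 0 ≤ b y) : 0 ≤ otError a b :=
  Finset.sum_nonneg fun x _ => Finset.sum_nonneg fun y _ => by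
    split_ifs
    exacts [mul_nonneg (ha x) (hb y), le_rfl]

theorem exists_ne_zero_of_mem_stdSimplex {U : Type} [Fintype U] {a : U → ℝ}
    (ha : a ∈ stdSimplex ℝ U) : ∃ u, a u ≠ 0 := by
  by_contra! h
  simpa [h] using ha.2

/-- Independent parties whose pair always satisfies the bit-OT relation: one of them is
deterministic, and the other one holds at most one bit of randomness. -/
theorem ent_add_ent_le_of_otError_eq_zero (hT : Fintype.card T = 2) {a : (Fin 2 → T) → ℝ}
    {b : Fin 2 × T → ℝ} (ha : a ∈ stdSimplex ℝ (Fin 2 → T)) (hb : b ∈ stdSimplex ℝ (Fin 2 × T))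
    (h : otError a b = 0) : ent a + ent b ≤ Real.log 2 := by
  have hc : ∀ x y, a x ≠ 0 → b y ≠ 0 → x y.1 = y.2 := by
    intro x y hx hy
    by_contra hne
    have h1 := (Finset.sum_eq_zero_iff_of_nonneg fun x _ => Finset.sum_nonneg fun y _ => by
      split_ifs
      exacts [mul_nonneg (ha.1 x) (hb.1 y), le_rfl]).1 h x (Finset.mem_univ x)
    have h2 := (Finset.sum_eq_zero_iff_of_nonneg fun y _ => by
      split_ifs
      exacts [mul_nonneg (ha.1 x) (hb.1 y), le_rfl]).1 h1 y (Finset.mem_univ y)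
    rw [if_pos hne] at h2
    exact (mul_ne_zero hx hy) h2
  obtain ⟨x₀, hx₀⟩ := exists_ne_zero_of_mem_stdSimplex ha
  obtain ⟨y₀, hy₀⟩ := exists_ne_zero_of_mem_stdSimplex hb
  -- If the sender is deterministic, the receiver is supported on the graph of `x₀`, which has two
  -- points.
  by_cases hx : ∀ x, a x ≠ 0 → x = x₀
  · have h1 := ent_le_log_card ha {x₀} fun u hu => by simpa using hx u hu
    have h2 := ent_le_log_card hb (Finset.univ.image fun c => (c, x₀ c)) fun u hu => by
      have := hc x₀ u hx₀ hu
      simp only [Finset.mem_image, Finset.mem_univ, true_and]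
      exact ⟨u.1, by rw [this]⟩
    rw [Finset.card_image_of_injective _ fun c d hcd => (Prod.mk.inj hcd).1] at h2
    simp at h1 h2
    linarith
  -- Two possible sender values differ at `c`, so the receiver never chooses `c`. Its choice, and
  -- with it its value, is then forced, and the sender is free only at `c`.
  · push Not at hx
    obtain ⟨x₁, hx₁, hne⟩ := hx
    obtain ⟨c, hcne⟩ := Function.ne_iff.1 hne
    have hyc : ∀ y, b y ≠ 0 → y.1 ≠ c := fun y hy hyc => hcne (by
      rw [← hyc, hc x₁ y hx₁ hy, hc x₀ y hx₀ hy])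
    have hy : ∀ y, b y ≠ 0 → y = y₀ := fun y hy => by
      have e : y.1 = y₀.1 := by
        have h1 := hyc y hy
        have h2 := hyc y₀ hy₀
        omega
      have : y.2 = y₀.2 := by rw [← hc x₀ y hx₀ hy, ← hc x₀ y₀ hx₀ hy₀, e]
      exact Prod.ext e this
    have h1 := ent_le_log_card hb {y₀} fun u hu => by simpa using hy u hu
    have h2 := ent_le_log_card ha (Finset.univ.filter fun x => x y₀.1 = y₀.2) fun u hu => by
      simpa using hc u y₀ hu hy₀
    have h3 : (Finset.univ.filter fun x : Fin 2 → T => x y₀.1 = y₀.2).card ≤ 2 := by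
      refine (Finset.card_le_card_of_injOn (t := (Finset.univ : Finset T))
        (fun x => x c) (fun _ _ => Finset.mem_univ _) ?_).trans_eq (Finset.card_univ.trans hT)
      intro x hx x' hx' hxx
      simp only [Finset.coe_filter, Finset.mem_univ, true_and, Set.mem_ofPred_eq] at hx hx'
      funext d
      have h1 := hyc y₀ hy₀
      by_cases hd : d = c
      · rw [hd]; exact hxx
      · have : d = y₀.1 := by omega
        rw [this, hx, hx']
    have h4 : Real.log ((Finset.univ.filter fun x : Fin 2 → T => x y₀.1 = y₀.2).card : ℝ)
        ≤ Real.log 2 := by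
      have hpos : 0 < (Finset.univ.filter fun x : Fin 2 → T => x y₀.1 = y₀.2).card :=
        Finset.card_pos.2 ⟨x₀, by simpa using hc x₀ y₀ hx₀ hy₀⟩
      exact Real.log_le_log (by exact_mod_cast hpos) (by exact_mod_cast h3)
    simp at h1
    linarith

/-- A robust form of `ent_add_ent_le_of_otError_eq_zero`. -/
theorem exists_ent_add_ent_le (hT : Fintype.card T = 2) {d : ℝ} (hd : 0 < d) :
    ∃ K : ℝ, 0 ≤ K ∧ ∀ a ∈ stdSimplex ℝ (Fin 2 → T), ∀ b ∈ stdSimplex ℝ (Fin 2 × T),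
      ent a + ent b ≤ Real.log 2 + d + K * otError a b := by
  -- On this compact set of pairs with too much entropy, the error is continuous and, by the exact
  -- statement, positive. Its minimum divides the trivial entropy bound `4 log 2` to give `K`.
  set s : Set (((Fin 2 → T) → ℝ) × (Fin 2 × T → ℝ)) :=
    (stdSimplex ℝ (Fin 2 → T) ×ˢ stdSimplex ℝ (Fin 2 × T)) ∩
      {q | Real.log 2 + d ≤ ent q.1 + ent q.2} with hs
  have hcont : Continuous fun q : ((Fin 2 → T) → ℝ) × (Fin 2 × T → ℝ) => ent q.1 + ent q.2 := by
    unfold ent; fun_prop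
  have hcont' : Continuous fun q : ((Fin 2 → T) → ℝ) × (Fin 2 × T → ℝ) => otError q.1 q.2 := by
    unfold otError
    refine continuous_finsetSum _ fun x _ => continuous_finsetSum _ fun y _ => ?_
    split_ifs
    · fun_prop
    · fun_prop
  have hcomp : IsCompact s :=
    ((isCompact_stdSimplex ℝ _).prod (isCompact_stdSimplex ℝ _)).inter_right
      (isClosed_le continuous_const hcont)
  have hbound : ∀ a ∈ stdSimplex ℝ (Fin 2 → T), ∀ b ∈ stdSimplex ℝ (Fin 2 × T),
      ent a + ent b ≤ 2 * Real.log 2 + 2 * Real.log 2 := by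
    intro a ha b hb
    have h1 := ent_le_log_card ha Finset.univ fun u _ => Finset.mem_univ u
    have h2 := ent_le_log_card hb Finset.univ fun u _ => Finset.mem_univ u
    simp [hT] at h1 h2
    have h4 : Real.log 4 = 2 * Real.log 2 := by
      rw [show (4 : ℝ) = 2 ^ 2 by norm_num, Real.log_pow]; norm_num
    rw [h4] at h1 h2
    linarith
  rcases s.eq_empty_or_nonempty with he | hne
  · refine ⟨0, le_rfl, fun a ha b hb => ?_⟩
    by_contra hlt
    have : (a, b) ∈ s := ⟨⟨ha, hb⟩, by simp at hlt ⊢; linarith⟩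
    rw [he] at this
    exact this
  · obtain ⟨q, hq, hmin⟩ := hcomp.exists_isMinOn hne hcont'.continuousOn
    have hpos : 0 < otError q.1 q.2 := by
      refine lt_of_le_of_ne (otError_nonneg hq.1.1.1 hq.1.2.1) fun h0 => ?_
      have := ent_add_ent_le_of_otError_eq_zero hT hq.1.1 hq.1.2 h0.symm
      have h3 : Real.log 2 + d ≤ ent q.1 + ent q.2 := hq.2
      linarith
    have hl : 0 < Real.log 2 := Real.log_pos (by norm_num)
    refine ⟨4 * Real.log 2 / otError q.1 q.2, by positivity, fun a ha b hb => ?_⟩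
    by_cases hab : (a, b) ∈ s
    · have h1 : otError q.1 q.2 ≤ otError a b := hmin hab
      have h2 : 4 * Real.log 2 ≤ 4 * Real.log 2 / otError q.1 q.2 * otError a b := by
        rw [div_mul_eq_mul_div, le_div_iff₀ hpos]
        gcongr
      have := hbound a ha b hb
      linarith
    · have h1 : ent a + ent b < Real.log 2 + d := by
        by_contra h
        exact hab ⟨⟨ha, hb⟩, not_lt.1 h⟩
      have : 0 ≤ 4 * Real.log 2 / otError q.1 q.2 * otError a b :=
        mul_nonneg (by positivity) (otError_nonneg ha.1 hb.1)
      linarith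

end OT

/-! ### Pairs of opposite oblivious transfers -/

/-- The strings of a share. -/
abbrev OTPairShare.sent {L : ℕ} (u : OTPairShare L) : Fin 2 → BitString L := u.2.1

/-- The choice of a share and the string received. -/
abbrev OTPairShare.got {L : ℕ} (u : OTPairShare L) : Fin 2 × BitString L := (u.1, u.2.2)

theorem card_bitString_one : Fintype.card (BitString 1) = 2 := by simp

theorem otError_marg {T U V : Type} [Fintype T] [DecidableEq T] [Fintype U] [Fintype V]
    (g : U → Fin 2 → T) (g' : V → Fin 2 × T) (a : U → ℝ) (b : V → ℝ) :
    otError (marg g a) (marg g' b) =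
      ∑ u, ∑ v, if g u (g' v).1 ≠ (g' v).2 then a u * b v else 0 := by
  have h1 : ∀ x, (∑ y, if x y.1 ≠ y.2 then marg g a x * marg g' b y else 0)
      = marg g a x * ∑ v, b v * (if x (g' v).1 ≠ (g' v).2 then 1 else 0) := fun x => by
    rw [← sum_marg_mul g' b fun y => if x y.1 ≠ y.2 then 1 else 0, Finset.mul_sum]
    refine Finset.sum_congr rfl fun y _ => ?_
    split_ifs <;> simp
  rw [otError, Finset.sum_congr rfl fun x _ => h1 x,
    sum_marg_mul g a fun x => ∑ v, b v * (if x (g' v).1 ≠ (g' v).2 then 1 else 0)]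
  refine Finset.sum_congr rfl fun u _ => ?_
  rw [Finset.mul_sum]
  refine Finset.sum_congr rfl fun v _ => ?_
  split_ifs <;> simp

/-- The number of failures among `2n` oblivious transfers. -/
noncomputable def failCount {n : ℕ} (u v : Fin n → OTPairShare 1) : ℝ :=
  ∑ i, ((if (u i).sent (v i).got.1 ≠ (v i).got.2 then 1 else 0) +
    if (v i).sent (u i).got.1 ≠ (u i).got.2 then 1 else 0)

theorem failCount_nonneg {n : ℕ} (u v : Fin n → OTPairShare 1) : 0 ≤ failCount u v :=
  Finset.sum_nonneg fun i _ => by positivity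

theorem failCount_le {n : ℕ} (u v : Fin n → OTPairShare 1) : failCount u v ≤ 2 * n := by
  calc failCount u v ≤ ∑ _i : Fin n, ((1 : ℝ) + 1) :=
        Finset.sum_le_sum fun i _ => add_le_add (by split_ifs <;> norm_num)
          (by split_ifs <;> norm_num)
    _ = 2 * n := by simp; ring

/-- Linearity of expectation: the expected number of failures under the product law is the sum of
the `2n` individual error probabilities. -/
theorem sum_otError_marg {n : ℕ} (a b : (Fin n → OTPairShare 1) → ℝ) :
    ∑ i, (otError (marg (fun u => (u i).sent) a) (marg (fun v => (v i).got) b) +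
      otError (marg (fun v => (v i).sent) b) (marg (fun u => (u i).got) a)) =
    ∑ u, ∑ v, a u * b v * failCount u v := by
  simp only [otError_marg, failCount, Finset.mul_sum, mul_add, Finset.sum_add_distrib]
  congr 1
  · rw [Finset.sum_comm]
    refine Finset.sum_congr rfl fun u _ => ?_
    rw [Finset.sum_comm]
    refine Finset.sum_congr rfl fun v _ => Finset.sum_congr rfl fun i _ => ?_
    split_ifs <;> simp
  · rw [Finset.sum_comm, Finset.sum_congr rfl fun u _ => Finset.sum_comm, Finset.sum_comm]
    refine Finset.sum_congr rfl fun u _ => Finset.sum_congr rfl fun v _ =>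
      Finset.sum_congr rfl fun i _ => ?_
    split_ifs <;> simp [mul_comm]

/-- Subadditivity cuts each party's shares into `2n` pieces. The strings of one party in position
`i` are matched with what the other party got there, and `hK` applies to each of the `2n` matched
pairs. -/
theorem ent_add_ent_le_of_otError_le {K d : ℝ}
    (hK : ∀ a ∈ stdSimplex ℝ (Fin 2 → BitString 1), ∀ b ∈ stdSimplex ℝ (Fin 2 × BitString 1),
      ent a + ent b ≤ Real.log 2 + d + K * otError a b) {n : ℕ}
    {a b : (Fin n → OTPairShare 1) → ℝ} (ha : a ∈ stdSimplex ℝ _) (hb : b ∈ stdSimplex ℝ _) :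
    ent a + ent b ≤ n * (2 * (Real.log 2 + d)) + K * ∑ u, ∑ v, a u * b v * failCount u v := by
  have hsub : ∀ {c : (Fin n → OTPairShare 1) → ℝ}, c ∈ stdSimplex ℝ _ →
      ent c ≤ ∑ i, (ent (marg (fun u => (u i).sent) c) + ent (marg (fun u => (u i).got) c)) := by
    intro c hc
    refine (ent_le_sum_marg (fun i u => u i) (fun u v h => funext fun i => congrFun h i) hc).trans
      (Finset.sum_le_sum fun i _ => ?_)
    have h1 := ent_le_marg_add_marg (a := marg (fun u : Fin n → OTPairShare 1 => u i) c)
      OTPairShare.sent OTPairShare.got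
      (fun u v h => by
        simp only [Prod.mk.injEq] at h
        exact Prod.ext h.2.1 (Prod.ext h.1 h.2.2)) (marg_mem_stdSimplex _ hc)
    have h2 : ∀ {T : Type} [Fintype T] (g : OTPairShare 1 → T),
        marg g (marg (fun u : Fin n → OTPairShare 1 => u i) c) = marg (fun u => g (u i)) c := by
      classical
      intro T _ g
      funext t
      have := sum_marg_mul (fun u : Fin n → OTPairShare 1 => u i) c
        fun s => if g s = t then 1 else 0
      simp only [mul_ite, mul_one, mul_zero] at this
      exact this
    rwa [h2, h2] at h1
  have h3 : ∀ i : Fin n,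
      ent (marg (fun u => (u i).sent) a) + ent (marg (fun u => (u i).got) a) +
        (ent (marg (fun u => (u i).sent) b) + ent (marg (fun u => (u i).got) b)) ≤
      2 * (Real.log 2 + d) +
        K * (otError (marg (fun u => (u i).sent) a) (marg (fun v => (v i).got) b) +
          otError (marg (fun v => (v i).sent) b) (marg (fun u => (u i).got) a)) := by
    intro i
    have h1 := hK _ (marg_mem_stdSimplex (fun u => (u i).sent) ha) _
      (marg_mem_stdSimplex (fun u => (u i).got) hb)
    have h2 := hK _ (marg_mem_stdSimplex (fun u => (u i).sent) hb) _
      (marg_mem_stdSimplex (fun u => (u i).got) ha)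
    linarith
  have h4 := Finset.sum_le_sum fun i (_ : i ∈ Finset.univ) => h3 i
  rw [Finset.sum_add_distrib, Finset.sum_add_distrib (f := fun _ => 2 * (Real.log 2 + d)),
    ← Finset.mul_sum, ← Finset.mul_sum, sum_otError_marg, Finset.sum_const, Finset.card_univ,
    Fintype.card_fin, nsmul_eq_mul] at h4
  have := hsub ha
  have := hsub hb
  linarith

/-! ### Expectations of nonnegative functions -/

/-- The expectation of a nonnegative function. -/
noncomputable def expect {α : Type*} (p : PMF α) (f : α → ℝ≥0∞) : ℝ≥0∞ := ∑' a, p a * f a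

section Expect

variable {α β : Type*}

theorem expect_map (p : PMF α) (g : α → β) (f : β → ℝ≥0∞) :
    expect (p.map g) f = expect p (f ∘ g) := by
  classical
  simp only [expect, PMF.map_apply, ← ENNReal.tsum_mul_right]
  rw [ENNReal.tsum_comm]
  refine tsum_congr fun a => ?_
  rw [tsum_eq_single (g a) fun b hb => by simp [hb]]
  simp

theorem expect_bind (p : PMF α) (k : α → PMF β) (f : β → ℝ≥0∞) :
    expect (p.bind k) f = expect p fun a => expect (k a) f := by
  simp only [expect, PMF.bind_apply, ← ENNReal.tsum_mul_right, ← ENNReal.tsum_mul_left]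
  rw [ENNReal.tsum_comm]
  simp only [mul_assoc]

theorem expect_const (p : PMF α) (c : ℝ≥0∞) : expect p (fun _ => c) = c := by
  rw [expect, ENNReal.tsum_mul_right, p.tsum_coe, one_mul]

theorem expect_add (p : PMF α) (f g : α → ℝ≥0∞) :
    expect p (fun a => f a + g a) = expect p f + expect p g := by
  simp only [expect, mul_add, ENNReal.tsum_add]

theorem expect_mono (p : PMF α) {f g : α → ℝ≥0∞} (h : ∀ a, p a ≠ 0 → f a ≤ g a) :
    expect p f ≤ expect p g :=
  ENNReal.tsum_le_tsum fun a => by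
    by_cases ha : p a = 0
    · simp [ha]
    · exact mul_le_mul_right (h a ha) _

theorem summable_toReal_pmf (p : PMF α) : Summable fun a => (p a).toReal :=
  ENNReal.summable_toReal p.tsum_coe_ne_top

theorem expect_ofReal (p : PMF α) (f : α → ℝ) :
    expect p (fun a => ENNReal.ofReal (f a)) = ∑' a, ENNReal.ofReal ((p a).toReal * f a) :=
  tsum_congr fun a => by
    rw [ENNReal.ofReal_mul ENNReal.toReal_nonneg, ENNReal.ofReal_toReal (p.apply_ne_top a)]

/-- The expectation of a function with values in `[0, M]` changes by at most `M` times the `ℓ¹`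
distance, which is twice the total variation distance. -/
theorem expect_le_of_tvDist_le {α : Type} {p q : PMF α} {ε M : ℝ} (h : tvDist p q ≤ ε)
    {f : α → ℝ} (hf : ∀ a, 0 ≤ f a) (hM : ∀ a, f a ≤ M) :
    expect p (fun a => ENNReal.ofReal (f a)) ≤
      expect q (fun a => ENNReal.ofReal (f a)) + ENNReal.ofReal (2 * M * ε) := by
  have hM0 : 0 ≤ M := by
    obtain ⟨a, -⟩ := p.support_nonempty
    exact (hf a).trans (hM a)
  have hs : Summable fun a => |(p a).toReal - (q a).toReal| :=
    ((summable_toReal_pmf p).sub (summable_toReal_pmf q)).abs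
  rw [expect_ofReal p f, expect_ofReal q f]
  calc ∑' a, ENNReal.ofReal ((p a).toReal * f a)
      ≤ ∑' a, (ENNReal.ofReal ((q a).toReal * f a) +
          ENNReal.ofReal (|(p a).toReal - (q a).toReal| * M)) := by
        refine ENNReal.tsum_le_tsum fun a => ?_
        rw [← ENNReal.ofReal_add (mul_nonneg ENNReal.toReal_nonneg (hf a))
          (mul_nonneg (abs_nonneg _) hM0)]
        refine ENNReal.ofReal_le_ofReal ?_
        have h1 : ((p a).toReal - (q a).toReal) * f a ≤ |(p a).toReal - (q a).toReal| * M :=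
          mul_le_mul (le_abs_self _) (hM a) (hf a) (abs_nonneg _)
        linarith
    _ = _ := by
        rw [ENNReal.tsum_add, ← ENNReal.ofReal_tsum_of_nonneg
          (fun a => mul_nonneg (abs_nonneg _) hM0) (hs.mul_right M), tsum_mul_right]
    _ ≤ _ := by
        refine add_le_add le_rfl (ENNReal.ofReal_le_ofReal ?_)
        have h1 : ∑' a, |(p a).toReal - (q a).toReal| ≤ 2 * ε := by
          unfold tvDist at h; linarith
        calc _ ≤ 2 * ε * M := mul_le_mul_of_nonneg_right h1 hM0
          _ = 2 * M * ε := by ring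

theorem tvDist_comm {α : Type} (p q : PMF α) : tvDist p q = tvDist q p := by
  simp only [tvDist, abs_sub_comm]

theorem tvDist_self {α : Type} (p : PMF α) : tvDist p p = 0 := by simp [tvDist]

end Expect

/-! ### Conditional laws -/

section Cond

variable {C Z W : Type}

/-- The conditional law of `w` given `z`. -/
noncomputable def condLaw (F : PMF C) (z : C → Z) (w : C → W) (z₀ : Z) (w₀ : W) : ℝ :=
  ((F.map fun c => (z c, w c)) (z₀, w₀) / (F.map z) z₀).toReal

theorem condLaw_nonneg (F : PMF C) (z : C → Z) (w : C → W) (z₀ : Z) (w₀ : W) :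
    0 ≤ condLaw F z w z₀ w₀ := ENNReal.toReal_nonneg

variable [Fintype W]

theorem sum_map_pair (F : PMF C) (z : C → Z) (w : C → W) (z₀ : Z) :
    ∑ w₀, (F.map fun c => (z c, w c)) (z₀, w₀) = (F.map z) z₀ := by
  classical
  simp only [PMF.map_apply]
  rw [← tsum_fintype (L := .unconditional W), ENNReal.tsum_comm]
  refine tsum_congr fun c => ?_
  rw [tsum_eq_single (w c) fun b hb => by simp [hb]]
  simp

theorem map_pair_le (F : PMF C) (z : C → Z) (w : C → W) (z₀ : Z) (w₀ : W) :
    (F.map fun c => (z c, w c)) (z₀, w₀) ≤ (F.map z) z₀ := by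
  rw [← sum_map_pair F z w z₀]
  exact Finset.single_le_sum (f := fun w₀ => (F.map fun c => (z c, w c)) (z₀, w₀))
    (fun _ _ => zero_le) (Finset.mem_univ w₀)

theorem mul_ofReal_condLaw (F : PMF C) (z : C → Z) (w : C → W) (z₀ : Z) (w₀ : W) :
    (F.map z) z₀ * ENNReal.ofReal (condLaw F z w z₀ w₀) =
      (F.map fun c => (z c, w c)) (z₀, w₀) := by
  have hle := map_pair_le F z w z₀ w₀
  rcases eq_or_ne ((F.map z) z₀) 0 with h0 | h0
  · rw [h0] at hle ⊢
    rw [le_antisymm hle zero_le, zero_mul]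
  · rw [condLaw, ENNReal.ofReal_toReal, ENNReal.mul_div_cancel h0 ((F.map z).apply_ne_top _)]
    exact ENNReal.div_ne_top ((F.map _).apply_ne_top _) h0

theorem condLaw_mem_stdSimplex (F : PMF C) (z : C → Z) (w : C → W) {z₀ : Z}
    (h : (F.map z) z₀ ≠ 0) : condLaw F z w z₀ ∈ stdSimplex ℝ W := by
  refine ⟨condLaw_nonneg F z w z₀, ?_⟩
  simp only [condLaw]
  rw [← ENNReal.toReal_sum fun w _ => ENNReal.div_ne_top ((F.map _).apply_ne_top _) h]
  simp only [div_eq_mul_inv]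
  rw [← Finset.sum_mul, sum_map_pair, ENNReal.mul_inv_cancel h ((F.map z).apply_ne_top _)]
  rfl

/-- On null values `0 / 0 = 0` makes the conditional law the zero vector, so the bound needs no
hypothesis. -/
theorem sum_condLaw_le_one (F : PMF C) (z : C → Z) (w : C → W) (z₀ : Z) :
    ∑ w₀, condLaw F z w z₀ w₀ ≤ 1 := by
  by_cases h : (F.map z) z₀ = 0
  · have : ∀ w₀, condLaw F z w z₀ w₀ = 0 := fun w₀ => by
      have := map_pair_le F z w z₀ w₀
      rw [h] at this
      simp [condLaw, le_antisymm this zero_le]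
    simp [this]
  · exact (condLaw_mem_stdSimplex F z w h).2.le

/-- The tower property. Since `W` is finite, the inner conditional expectation is a finite real sum
even if `Z` is infinite. -/
theorem expect_eq_tsum_condLaw (F : PMF C) (z : C → Z) (w : C → W) {g : Z → W → ℝ}
    (hg : ∀ z w, 0 ≤ g z w) :
    expect F (fun c => ENNReal.ofReal (g (z c) (w c))) =
      expect (F.map z) fun z₀ => ENNReal.ofReal (∑ w₀, condLaw F z w z₀ w₀ * g z₀ w₀) := by
  have h1 : expect F (fun c => ENNReal.ofReal (g (z c) (w c))) =
      expect (F.map fun c => (z c, w c)) fun x => ENNReal.ofReal (g x.1 x.2) := by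
    rw [expect_map]; rfl
  rw [h1, expect, expect]
  refine (ENNReal.tsum_prod (f := fun z₀ w₀ =>
    (F.map fun c => (z c, w c)) (z₀, w₀) * ENNReal.ofReal (g z₀ w₀))).trans ?_
  refine tsum_congr fun z₀ => ?_
  rw [tsum_fintype, ENNReal.ofReal_sum_of_nonneg fun w₀ _ =>
    mul_nonneg (condLaw_nonneg _ _ _ _ _) (hg _ _), Finset.mul_sum]
  refine Finset.sum_congr rfl fun w₀ _ => ?_
  rw [ENNReal.ofReal_mul (condLaw_nonneg _ _ _ _ _), ← mul_assoc, mul_ofReal_condLaw]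

end Cond

/-! ### Cross entropies -/

/-- A vector mixed with the uniform distribution. -/
noncomputable def smooth {W : Type} [Fintype W] (δ : ℝ) (a : W → ℝ) (w : W) : ℝ :=
  (1 - δ) * a w + δ / Fintype.card W

section Cross

variable {W : Type} [Fintype W]

/-- This floor bounds the surprisal by `log (|W| / δ)`, as is needed to compare expectations through
total variation. -/
theorem le_smooth {δ : ℝ} (hδ : δ < 1) {a : W → ℝ} (ha : ∀ w, 0 ≤ a w) (w : W) :
    δ / Fintype.card W ≤ smooth δ a w :=
  le_add_of_nonneg_left (mul_nonneg (by linarith) (ha w))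

theorem sum_smooth_le [Nonempty W] {δ : ℝ} (hδ : δ < 1) {a : W → ℝ} (ha : ∑ w, a w ≤ 1) :
    ∑ w, smooth δ a w ≤ 1 := by
  have hc : (Fintype.card W : ℝ) ≠ 0 := by exact_mod_cast Fintype.card_ne_zero
  simp only [smooth, Finset.sum_add_distrib, ← Finset.mul_sum, Finset.sum_const,
    Finset.card_univ, nsmul_eq_mul]
  rw [mul_div_cancel₀ _ hc]
  nlinarith

/-- The smoothed vector is at least `(1 - δ) a`, so smoothing costs at most `-log (1 - δ)`. -/
theorem cross_smooth_le {δ : ℝ} (h0 : 0 < δ) (hδ : δ < 1) {a : W → ℝ}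
    (ha : a ∈ stdSimplex ℝ W) :
    ∑ w, a w * (-Real.log (smooth δ a w)) ≤ ent a - Real.log (1 - δ) := by
  have h1 : ∀ w, a w * (-Real.log (smooth δ a w)) ≤
      Real.negMulLog (a w) + a w * (-Real.log (1 - δ)) := fun w => by
    rcases (ha.1 w).eq_or_lt with h | h
    · simp [← h]
    · have h2 : Real.log ((1 - δ) * a w) ≤ Real.log (smooth δ a w) :=
        Real.log_le_log (mul_pos (by linarith) h)
          (le_add_of_nonneg_right (by positivity))
      rw [Real.log_mul (by linarith) h.ne'] at h2
      have := mul_le_mul_of_nonneg_left h2 h.le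
      simp only [Real.negMulLog]
      linarith
  refine (Finset.sum_le_sum fun w _ => h1 w).trans_eq ?_
  rw [Finset.sum_add_distrib, ← Finset.sum_mul, ha.2, ent]
  ring

end Cross

/-! ### Conditionally independent pairs -/

section Independent

variable {A B U V Z : Type}

/-- On every fibre of `z`, the law `F` is a product measure up to a constant. -/
def RankOneOn (F : PMF (A × B)) (z : A × B → Z) : Prop :=
  ∀ a b a' b', F (a, b) ≠ 0 → F (a', b') ≠ 0 → z (a, b) = z (a', b') →
    z (a, b') = z (a, b) ∧ z (a', b) = z (a, b) ∧ F (a, b) * F (a', b') = F (a, b') * F (a', b)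

/-- The equivalence that exchanges the second components. -/
def swapSnd (A B : Type) : (A × B) × (A × B) ≃ (A × B) × (A × B) where
  toFun p := ((p.1.1, p.2.2), (p.2.1, p.1.2))
  invFun p := ((p.1.1, p.2.2), (p.2.1, p.1.2))
  left_inv _ := rfl
  right_inv _ := rfl

/-- Both sides are sums over pairs of points in one fibre. Exchanging the second components permutes
these pairs and preserves the product of their masses. -/
theorem RankOneOn.map_mul {F : PMF (A × B)} {z : A × B → Z} (h : RankOneOn F z) (u : A → U)
    (v : B → V) (z₀ : Z) (u₀ : U) (v₀ : V) :
    (F.map fun c => (z c, (u c.1, v c.2))) (z₀, (u₀, v₀)) * (F.map z) z₀ =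
      (F.map fun c => (z c, u c.1)) (z₀, u₀) * (F.map fun c => (z c, v c.2)) (z₀, v₀) := by
  classical
  set G : A × B → ℝ≥0∞ := fun c => if z₀ = z c then F c else 0 with hG
  -- The hypothesis speaks only of points of positive mass, which yields one inequality. Applying it
  -- again with `b` and `b'` exchanged yields the other.
  have hle : ∀ a b a' b', G (a, b) * G (a', b') ≤ G (a, b') * G (a', b) := by
    intro a b a' b'
    by_cases h0 : G (a, b) * G (a', b') = 0
    · rw [h0]; exact zero_le
    · obtain ⟨h1, h2⟩ := mul_ne_zero_iff.1 h0
      simp only [hG, ne_eq, ite_eq_right_iff, not_forall] at h1 h2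
      obtain ⟨h1z, h1F⟩ := h1
      obtain ⟨h2z, h2F⟩ := h2
      obtain ⟨h3, h4, h5⟩ := h a b a' b' h1F h2F (h1z.symm.trans h2z)
      simp only [hG]
      rw [if_pos h1z, if_pos h2z, if_pos (h1z.trans h3.symm), if_pos (h1z.trans h4.symm), h5]
  have heq : ∀ a b a' b', G (a, b) * G (a', b') = G (a, b') * G (a', b) := fun a b a' b' =>
    le_antisymm (hle a b a' b') (hle a b' a' b)
  have hprod : ∀ f g : A × B → ℝ≥0∞, (∑' c, f c) * ∑' c, g c = ∑' p : (A × B) × (A × B),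
      f p.1 * g p.2 := fun f g => by
    rw [ENNReal.tsum_prod (f := fun c d => f c * g d)]
    simp only [ENNReal.tsum_mul_left, ENNReal.tsum_mul_right]
  simp only [PMF.map_apply]
  rw [hprod, hprod, ← (swapSnd A B).tsum_eq]
  refine tsum_congr fun p => ?_
  obtain ⟨⟨a, b⟩, ⟨a', b'⟩⟩ := p
  have := heq a b' a' b
  simp only [swapSnd, Equiv.coe_fn_mk, Prod.mk.injEq]
  simp only [hG] at this
  by_cases hu : u₀ = u a <;> by_cases hv : v₀ = v b' <;> simp only [hu, hv, and_true, and_false,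
    if_false, zero_mul, mul_zero]
  exact this

theorem RankOneOn.condLaw_mul {F : PMF (A × B)} {z : A × B → Z} (h : RankOneOn F z) (u : A → U)
    (v : B → V) {z₀ : Z} (h0 : (F.map z) z₀ ≠ 0) (u₀ : U) (v₀ : V) :
    condLaw F z (fun c => (u c.1, v c.2)) z₀ (u₀, v₀) =
      condLaw F z (fun c => u c.1) z₀ u₀ * condLaw F z (fun c => v c.2) z₀ v₀ := by
  have h1 := h.map_mul u v z₀ u₀ v₀
  have ht : ((F.map z) z₀).toReal ≠ 0 := ENNReal.toReal_ne_zero.2 ⟨h0, (F.map z).apply_ne_top z₀⟩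
  have h2 := congrArg ENNReal.toReal h1
  simp only [ENNReal.toReal_mul] at h2
  simp only [condLaw, ENNReal.toReal_div]
  field_simp
  exact h2

variable [Fintype U] [Fintype V]

/-- If `u` and `v` are independent given `z`, a bound for independent pairs of laws bounds the sum
of the cross entropies of `u` and `v` given `z`. -/
theorem RankOneOn.expect_cross_add_le {F : PMF (A × B)} {z : A × B → Z} (h : RankOneOn F z)
    (u : A → U) (v : B → V) {δ : ℝ} (hδ₀ : 0 < δ) (hδ : δ < 1) {E : ℝ} {N : U → V → ℝ}
    (hE : 0 ≤ E) (hN : ∀ u v, 0 ≤ N u v)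
    (hloc : ∀ a ∈ stdSimplex ℝ U, ∀ b ∈ stdSimplex ℝ V,
      ent a + ent b ≤ E + ∑ u, ∑ v, a u * b v * N u v) [Nonempty U] [Nonempty V] :
    expect F (fun c => ENNReal.ofReal
        (-Real.log (smooth δ (condLaw F z (fun c => u c.1) (z c)) (u c.1)))) +
      expect F (fun c => ENNReal.ofReal
        (-Real.log (smooth δ (condLaw F z (fun c => v c.2) (z c)) (v c.2)))) ≤
    expect F fun c => ENNReal.ofReal (E - 2 * Real.log (1 - δ) + N (u c.1) (v c.2)) := by
  have hlog : 0 ≤ -Real.log (1 - δ) := by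
    have := Real.log_nonpos (by linarith : 0 ≤ 1 - δ) (by linarith)
    linarith
  have hs : ∀ {W : Type} [Fintype W] [Nonempty W] (w : A × B → W) (z₀ : Z) (w₀ : W),
      0 ≤ -Real.log (smooth δ (condLaw F z w z₀) w₀) := by
    intro W _ _ w z₀ w₀
    have h1 := le_smooth hδ (condLaw_nonneg F z w z₀)
    have hpos : 0 ≤ δ / Fintype.card W := by positivity
    have h2 := sum_smooth_le hδ (sum_condLaw_le_one F z w z₀)
    have h3 := Finset.single_le_sum (f := smooth δ (condLaw F z w z₀))
      (fun w _ => hpos.trans (h1 w)) (Finset.mem_univ w₀)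
    have := Real.log_nonpos (hpos.trans (h1 w₀)) (h3.trans h2)
    linarith
  rw [expect_eq_tsum_condLaw F z (fun c => u c.1)
      (g := fun z₀ w => -Real.log (smooth δ (condLaw F z (fun c => u c.1) z₀) w))
      fun _ _ => hs _ _ _,
    expect_eq_tsum_condLaw F z (fun c => v c.2)
      (g := fun z₀ w => -Real.log (smooth δ (condLaw F z (fun c => v c.2) z₀) w))
      fun _ _ => hs _ _ _,
    expect_eq_tsum_condLaw F z (fun c => (u c.1, v c.2))
      (g := fun _ w => E - 2 * Real.log (1 - δ) + N w.1 w.2)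
      fun _ w => by have := hN w.1 w.2; linarith,
    ← expect_add]
  -- Fibre by fibre, the joint conditional law is a product of probability vectors, so `hloc`
  -- applies. Each of the two smoothings costs `-log (1 - δ)`.
  refine expect_mono _ fun z₀ h0 => ?_
  have hu := condLaw_mem_stdSimplex F z (fun c => u c.1) h0
  have hv := condLaw_mem_stdSimplex F z (fun c => v c.2) h0
  have huv := condLaw_mem_stdSimplex F z (fun c => (u c.1, v c.2)) h0
  rw [← ENNReal.ofReal_add (Finset.sum_nonneg fun w _ => mul_nonneg (hu.1 w) (hs _ _ _))
    (Finset.sum_nonneg fun w _ => mul_nonneg (hv.1 w) (hs _ _ _))]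
  refine ENNReal.ofReal_le_ofReal ?_
  have h1 := cross_smooth_le hδ₀ hδ hu
  have h2 := cross_smooth_le hδ₀ hδ hv
  have h3 := hloc _ hu _ hv
  have h4 : ∑ w : U × V, condLaw F z (fun c => (u c.1, v c.2)) z₀ w *
      (E - 2 * Real.log (1 - δ) + N w.1 w.2) = E - 2 * Real.log (1 - δ) +
      ∑ u₀, ∑ v₀, condLaw F z (fun c => u c.1) z₀ u₀ * condLaw F z (fun c => v c.2) z₀ v₀ *
        N u₀ v₀ := by
    simp only [mul_add _ (E - 2 * Real.log (1 - δ)), Finset.sum_add_distrib]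
    rw [← Finset.sum_mul, huv.2, one_mul, Fintype.sum_prod_type]
    simp only [h.condLaw_mul u v h0]
  rw [h4]
  linarith

end Independent

/-! ### Lower bounds on cross entropies -/

section Lower

variable {C S U V Z K : Type} [Fintype K] [Nonempty K]

/-- The average of a family of vectors. -/
noncomputable def average (r : K → V → ℝ) (v : V) : ℝ := (∑ k, r k v) / Fintype.card K

theorem average_le_one_of_sum_le [Fintype V] {r : K → V → ℝ} (h : ∀ k, ∑ v, r k v ≤ 1) :
    ∑ v, average r v ≤ 1 := by
  have hc : (0 : ℝ) < Fintype.card K := by exact_mod_cast Fintype.card_pos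
  simp only [average]
  rw [← Finset.sum_div, Finset.sum_comm, div_le_one hc]
  calc ∑ k, ∑ v, r k v ≤ ∑ _k : K, (1 : ℝ) := Finset.sum_le_sum fun k _ => h k
    _ = Fintype.card K := by simp

theorem le_average {r : K → V → ℝ} {m : ℝ} {v : V} (h : ∀ k, m ≤ r k v) : m ≤ average r v := by
  have hc : (0 : ℝ) < Fintype.card K := by exact_mod_cast Fintype.card_pos
  rw [average, le_div_iff₀ hc]
  calc m * Fintype.card K = ∑ _k : K, m := by simp [mul_comm]
    _ ≤ _ := Finset.sum_le_sum fun k _ => h k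

/-- A side value `κ` in a finite alphabet lowers a cross entropy by at most `log |K|`. -/
theorem expect_average_le (F : PMF C) (z : C → Z) (v : C → V) (s : C → S) (κ : C → K)
    (φ : S → K → Z) (hz : ∀ c, F c ≠ 0 → z c = φ (s c) (κ c)) {r : Z → V → ℝ}
    (hr : ∀ z v, 0 < r z v) :
    expect F (fun c => ENNReal.ofReal (-Real.log (average (fun k => r (φ (s c) k)) (v c)))) ≤
      expect F (fun c => ENNReal.ofReal (-Real.log (r (z c) (v c)))) +
        ENNReal.ofReal (Real.log (Fintype.card K)) := by
  rw [← expect_const F (ENNReal.ofReal (Real.log (Fintype.card K))), ← expect_add]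
  refine expect_mono _ fun c hc => le_trans (ENNReal.ofReal_le_ofReal ?_) ENNReal.ofReal_add_le
  have hcard : (0 : ℝ) < Fintype.card K := by exact_mod_cast Fintype.card_pos
  -- The average contains the term of the true side value with weight `1 / |K|`.
  have h1 : r (z c) (v c) / Fintype.card K ≤ average (fun k => r (φ (s c) k)) (v c) := by
    rw [average]
    gcongr
    rw [hz c hc]
    exact Finset.single_le_sum (f := fun k => r (φ (s c) k) (v c)) (fun k _ => (hr _ _).le)
      (Finset.mem_univ _)
  have h2 := Real.log_le_log (div_pos (hr _ _) hcard) h1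
  rw [Real.log_div (hr _ _).ne' hcard.ne'] at h2
  linarith

/-- If `v` is uniform on `m / c` values given `u`, its cross entropy given a simulation from `u`
is at least `log (m / c)`. -/
theorem le_expect_bind_sim [Fintype U] [Fintype V] (q : PMF (U × V)) {c m : ℝ} (hc : 0 < c) (hm : 0 < m)
    (hq : ∀ u v, q (u, v) ≠ 0 → (q (u, v)).toReal = c)
    (hsum : ∀ u, ∑ v, (q (u, v)).toReal = m) (sim : U → PMF S) {s : S → V → ℝ}
    (hs : ∀ σ v, 0 < s σ v) (hs1 : ∀ σ, ∑ v, s σ v ≤ 1) :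
    ENNReal.ofReal (Real.log (m / c)) ≤
      expect q fun uv => expect (sim uv.1) fun σ => ENNReal.ofReal (-Real.log (s σ uv.2)) := by
  have hle1 : ∀ σ v, s σ v ≤ 1 := fun σ v =>
    (Finset.single_le_sum (fun v _ => (hs σ v).le) (Finset.mem_univ v)).trans (hs1 σ)
  have hneg : ∀ σ v, 0 ≤ -Real.log (s σ v) := fun σ v => by
    have := Real.log_nonpos (hs σ v).le (hle1 σ v)
    linarith
  -- Given `u`, the simulated `σ` is independent of `v`. So `σ` can be fixed and Gibbs' inequality
  -- applied to the unnormalised vector `q (u, ·)` of mass `m`.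
  have key : ∀ u σ, ENNReal.ofReal m * ENNReal.ofReal (Real.log (m / c)) ≤
      ∑ v, q (u, v) * ENNReal.ofReal (-Real.log (s σ v)) := by
    intro u σ
    have h1 := ent_le_cross (a := fun v => (q (u, v)).toReal) (r := fun v => m * s σ v)
      (fun v => ENNReal.toReal_nonneg) (fun v => (mul_pos hm (hs σ v)).le)
      (fun v _ => (mul_pos hm (hs σ v)).ne')
      (by rw [← Finset.mul_sum, hsum u]; exact mul_le_of_le_one_right hm.le (hs1 σ))
    have h2 : ent (fun v => (q (u, v)).toReal) = m * (-Real.log c) := by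
      rw [ent, ← hsum u, Finset.sum_mul]
      refine Finset.sum_congr rfl fun v _ => ?_
      by_cases h0 : q (u, v) = 0
      · simp [h0]
      · simp [Real.negMulLog, hq u v h0]
    have h3 : ∑ v, (q (u, v)).toReal * (-Real.log (m * s σ v)) =
        m * (-Real.log m) + ∑ v, (q (u, v)).toReal * (-Real.log (s σ v)) := by
      nth_rewrite 2 [← hsum u]
      rw [Finset.sum_mul, ← Finset.sum_add_distrib]
      refine Finset.sum_congr rfl fun v _ => ?_
      rw [Real.log_mul hm.ne' (hs σ v).ne']
      ring
    rw [h2, h3] at h1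
    rw [← ENNReal.ofReal_mul hm.le, Real.log_div hm.ne' hc.ne']
    calc _ ≤ ENNReal.ofReal (∑ v, (q (u, v)).toReal * (-Real.log (s σ v))) :=
          ENNReal.ofReal_le_ofReal (by linarith)
      _ = _ := by
        rw [ENNReal.ofReal_sum_of_nonneg fun v _ => mul_nonneg ENNReal.toReal_nonneg (hneg σ v)]
        refine Finset.sum_congr rfl fun v _ => ?_
        rw [ENNReal.ofReal_mul ENNReal.toReal_nonneg, ENNReal.ofReal_toReal (q.apply_ne_top _)]
  have htot : ∑ _u : U, ENNReal.ofReal m = 1 := by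
    have : ∀ u, ENNReal.ofReal m = ∑ v, q (u, v) := fun u => by
      rw [← hsum u, ENNReal.ofReal_sum_of_nonneg fun v _ => ENNReal.toReal_nonneg]
      exact Finset.sum_congr rfl fun v _ => ENNReal.ofReal_toReal (q.apply_ne_top _)
    rw [Finset.sum_congr rfl fun u _ => this u, ← Fintype.sum_prod_type, ← tsum_fintype (L := .unconditional _)]
    exact q.tsum_coe
  calc ENNReal.ofReal (Real.log (m / c))
      = ∑ u : U, expect (sim u) fun _ => ENNReal.ofReal m * ENNReal.ofReal (Real.log (m / c)) := by
        simp only [expect_const]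
        rw [← Finset.sum_mul, htot, one_mul]
    _ ≤ ∑ u : U, expect (sim u) fun σ => ∑ v, q (u, v) * ENNReal.ofReal (-Real.log (s σ v)) :=
        Finset.sum_le_sum fun u _ => expect_mono _ fun σ _ => key u σ
    _ = _ := by
        simp only [expect]
        rw [tsum_fintype, Fintype.sum_prod_type]
        refine Finset.sum_congr rfl fun u _ => ?_
        simp only [Finset.mul_sum, ← ENNReal.tsum_mul_left]
        rw [Summable.tsum_finsetSum fun _ _ => ENNReal.summable]
        refine Finset.sum_congr rfl fun v _ => tsum_congr fun σ => ?_
        ring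

end Lower

/-! ### Transcripts -/

section Transcript

variable {X Y W W' M O O' : Type}

/-- The entry of the transcript for an event in the view of party `t`: the party that moved, and
its message (`none` if it terminated). -/
def Event.tag (t : Bool) : Event W M O → Bool × Option M
  | .act _ r => (t, r.getLeft?)
  | .recv m => (!t, m)

/-- A transcript, latest entry first, that ends with a termination. -/
def Closed (l : List (Bool × Option M)) : Prop := ∃ s, l.head? = some (s, none)

open Classical in
/-- The transcript up to the first termination, as seen by party `t`. -/
noncomputable def transcript (t : Bool) : List (Event W M O) → List (Bool × Option M)
  | [] => []
  | e :: l => if Closed (transcript t l) then transcript t l else e.tag t :: transcript t l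

/-- The transcript of a view, up to the first termination. -/
noncomputable def View.trans (t : Bool) (v : View X W M O) : List (Bool × Option M) :=
  transcript t v.events

/-- The view before the latest event. -/
def View.tail (v : View X W M O) : View X W M O := ⟨v.input, v.events.tail⟩

theorem View.eq_add_iff {v v' : View X W M O} {e : Event W M O} :
    v' = v.add e ↔ v = v'.tail ∧ v' = v'.tail.add e := by
  constructor
  · rintro rfl
    exact ⟨rfl, rfl⟩
  · rintro ⟨rfl, h⟩
    exact h

open Classical in
theorem View.trans_add (t : Bool) (v : View X W M O) (e : Event W M O) :
    (v.add e).trans t = if Closed (v.trans t) then v.trans t else e.tag t :: v.trans t := rfl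

theorem View.trans_add_of_closed {t : Bool} {v : View X W M O} (h : Closed (v.trans t))
    (e : Event W M O) : (v.add e).trans t = v.trans t := by
  rw [View.trans_add, if_pos h]

theorem View.trans_add_of_not_closed {t : Bool} {v : View X W M O} (h : ¬ Closed (v.trans t))
    (e : Event W M O) : (v.add e).trans t = e.tag t :: v.trans t := by
  rw [View.trans_add, if_neg h]

theorem View.output_of_head {t : Bool} {v : View X W M O}
    (h : (v.trans t).head? = some (t, none)) : v.output.isSome := by
  obtain ⟨i, l⟩ := v
  simp only [View.trans, View.output] at *
  induction l with
  | nil => simp [transcript] at h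
  | cons e l ih =>
    rw [transcript] at h
    split_ifs at h with hc
    · have := ih h
      cases he : Event.output e <;> simp [he, this]
    · simp only [List.head?_cons, Option.some.injEq] at h
      cases e with
      | act w r =>
        cases r with
        | inl m => simp [Event.tag] at h
        | inr o => simp [List.findSome?_cons, Event.output]
      | recv m => simp [Event.tag] at h

theorem View.closed_of_output (t : Bool) {v : View X W M O} (h : v.output.isSome) :
    Closed (v.trans t) := by
  obtain ⟨i, l⟩ := v
  simp only [View.trans, View.output] at *
  induction l with
  | nil => simp at h
  | cons e l ih =>
    rw [transcript]
    split_ifs with hc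
    · exact hc
    · cases e with
      | act w r =>
        cases r with
        | inl m => exact absurd (ih (by simpa [List.findSome?_cons, Event.output] using h)) hc
        | inr o => exact ⟨t, rfl⟩
      | recv m => exact absurd (ih (by simpa [List.findSome?_cons, Event.output] using h)) hc

/-- A party still running cannot have recorded its own termination. A terminated party ignores later
messages, so only the transcript up to the first termination is common to both views. -/
theorem View.head_of_closed {t : Bool} {v : View X W M O} (h : Closed (v.trans t))
    (hv : ¬ v.output.isSome) : (v.trans t).head? = some (!t, none) := by
  obtain ⟨s, hs⟩ := h
  by_cases hst : s = t
  · exact absurd (View.output_of_head (hst ▸ hs)) hv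
  · have : s = !t := by revert hst; cases s <;> cases t <;> simp
    rw [hs, this]

/-- The transcripts possible after `k` turns. -/
def GoodLength (k : ℕ) (l : List (Bool × Option M)) : Prop :=
  l.length ≤ k ∧ (¬ Closed l → l.length = k)

open Classical in
/-- After `k` turns, the law `P` of the views of party `t` and of the other party is a product on
every set of pairs of views with the same transcript, up to the law `g` of the set up. -/
def Factors (t : Bool) (k : ℕ) (g : X → Y → ℝ≥0∞)
    (P : PMF (View X W M O × View Y W' M O')) : Prop :=
  ∃ (a : View X W M O → ℝ≥0∞) (b : View Y W' M O' → ℝ≥0∞),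
    (∀ x y, P (x, y) = if x.trans t = y.trans (!t) then g x.input y.input * a x * b y else 0) ∧
    (∀ x, a x ≠ 0 → GoodLength k (x.trans t)) ∧ ∀ y, b y ≠ 0 → GoodLength k (y.trans (!t))

theorem map_swap_apply {α β : Type*} (P : PMF (α × β)) (a : α) (b : β) :
    (P.map Prod.swap) (b, a) = P (a, b) := by
  classical
  rw [PMF.map_apply, tsum_eq_single (a, b) fun c hc => ?_]
  · simp
  · rw [if_neg]
    rintro h
    exact hc (by simpa using (congrArg Prod.swap h).symm)

theorem Factors.swap {t : Bool} {k : ℕ} {g : X → Y → ℝ≥0∞}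
    {P : PMF (View X W M O × View Y W' M O')} (h : Factors t k g P) :
    Factors (!t) k (fun y x => g x y) (P.map Prod.swap) := by
  obtain ⟨a, b, h, ha, hb⟩ := h
  refine ⟨b, a, fun y x => ?_, hb, by simpa using ha⟩
  rw [map_swap_apply, h, Bool.not_not]
  by_cases e : x.trans t = y.trans (!t)
  · rw [if_pos e, if_pos e.symm]; ring
  · rw [if_neg e, if_neg fun h => e h.symm]

-- A view has at most two preimages under `View.receive`: itself, if its party has terminated, and
-- its tail, if its last event is the reception.
open Classical in
theorem tsum_receive (f : View Y W' M O' → ℝ≥0∞) (m : Option M) (y' : View Y W' M O') :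
    ∑' y, (if y' = y.receive m then f y else 0) =
      (if y'.output.isSome then f y' else 0) +
        if ¬ y'.tail.output.isSome ∧ y' = y'.tail.add (.recv m) then f y'.tail else 0 := by
  have h1 : ∀ y, (if y' = y.receive m then f y else 0) =
      (if y.output.isSome ∧ y' = y then f y else 0) +
        if ¬ y.output.isSome ∧ y' = y.add (.recv m) then f y else 0 := by
    intro y
    unfold View.receive
    by_cases hy : y.output.isSome <;> simp [hy]
  rw [tsum_congr h1, ENNReal.tsum_add]
  congr 1
  · rw [tsum_eq_single y' fun y hy => by simp [Ne.symm hy]]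
    simp
  · rw [tsum_eq_single y'.tail fun y hy => by
      rw [if_neg]; rintro ⟨-, h⟩; exact hy (View.eq_add_iff.1 h).1]

-- The one-step recursion for the law: the mover either had already terminated or moved from the
-- view `x'.tail`.
open Classical in
theorem bind_takeTurn_apply (π : View X W M O → PMF (W × (M ⊕ O)))
    (P : PMF (View X W M O × View Y W' M O')) (x' : View X W M O) (y' : View Y W' M O') :
    (P.bind fun c => takeTurn π c.1 c.2) (x', y') =
      (if x'.output.isSome then P (x', y') else 0) +
      if x'.tail.output.isSome then 0 else ∑' s, if x' = x'.tail.add (.act s.1 s.2) then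
        π x'.tail s * ((if y'.output.isSome then P (x'.tail, y') else 0) +
          if ¬ y'.tail.output.isSome ∧ y' = y'.tail.add (.recv s.2.getLeft?) then
            P (x'.tail, y'.tail) else 0) else 0 := by
  rw [PMF.bind_apply]
  refine (ENNReal.tsum_prod (f := fun x y => P (x, y) * takeTurn π x y (x', y'))).trans ?_
  have h1 : ∀ x, ∑' y, P (x, y) * takeTurn π x y (x', y') =
      (if x.output.isSome ∧ x' = x then P (x, y') else 0) +
      if x.output.isSome then 0 else ∑' s, if x' = x.add (.act s.1 s.2) then
        π x s * ∑' y, (if y' = y.receive s.2.getLeft? then P (x, y) else 0) else 0 := by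
    intro x
    by_cases hx : x.output.isSome
    · simp only [takeTurn, hx, if_true, true_and, add_zero, PMF.pure_apply, Prod.mk.injEq]
      rw [tsum_eq_single y' fun y hy => by simp [Ne.symm hy]]
      simp
    · simp only [takeTurn, hx, if_false, PMF.map_apply, Prod.mk.injEq, false_and, zero_add,
        Bool.false_eq_true, ← ENNReal.tsum_mul_left]
      rw [ENNReal.tsum_comm]
      refine tsum_congr fun s => ?_
      by_cases hs : x' = x.add (.act s.1 s.2)
      · simp only [hs, true_and, if_true]
        refine tsum_congr fun y => ?_
        split_ifs
        · exact mul_comm _ _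
        · simp
      · simp [hs]
  rw [tsum_congr h1, ENNReal.tsum_add]
  congr 1
  · rw [tsum_eq_single x' fun x hx => by simp [Ne.symm hx]]
    simp
  · rw [tsum_eq_single x'.tail fun x hx => ?_]
    · simp only [tsum_receive]
    · split_ifs
      · rfl
      · refine ENNReal.tsum_eq_zero.2 fun s => ?_
        rw [if_neg]
        exact fun h => hx (View.eq_add_iff.1 h).1

/-- The mover acts after the other party has terminated. The condition on the old views becomes
equality of the new transcripts and a condition on the mover's new transcript alone, so the product
form survives. -/
theorem trans_eq_iff_of_output {t : Bool} {k : ℕ} {x : View X W M O} {y' : View Y W' M O'}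
    {e : Event W M O} (hx : ¬ x.output.isSome) (hk : GoodLength k (x.trans t)) :
    (y'.output.isSome ∧ x.trans t = y'.trans (!t)) ↔
      ((x.add e).trans t = y'.trans (!t) ∧ ((x.add e).trans t).length ≠ k + 1 ∧
        ((x.add e).trans t).head? = some (!t, none)) := by
  constructor
  · rintro ⟨hy, hxy⟩
    have hc : Closed (x.trans t) := hxy ▸ View.closed_of_output (!t) hy
    rw [View.trans_add_of_closed hc]
    exact ⟨hxy, by have := hk.1; omega, View.head_of_closed hc hx⟩
  · rintro ⟨hxy, hlen, hhead⟩
    refine ⟨View.output_of_head (hxy ▸ hhead), ?_⟩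
    by_cases hc : Closed (x.trans t)
    · rwa [View.trans_add_of_closed hc] at hxy
    · rw [View.trans_add_of_not_closed hc, List.length_cons, hk.2 hc] at hlen
      exact absurd rfl hlen

/-- Both parties were running, and both transcripts grow. That the message received is the one sent
is absorbed into equality of the new transcripts, which leaves a condition on the receiver's views
alone. -/
theorem trans_eq_iff_of_recv {t : Bool} {k : ℕ} {x : View X W M O} {y y' : View Y W' M O'}
    {w : W} {r : M ⊕ O} (hx : ¬ x.output.isSome) (hk : GoodLength k (x.trans t))
    (hk' : GoodLength k (y.trans (!t))) :
    ((¬ y.output.isSome ∧ y' = y.add (.recv r.getLeft?)) ∧ x.trans t = y.trans (!t)) ↔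
      ((x.add (.act w r)).trans t = y'.trans (!t) ∧ ((x.add (.act w r)).trans t).length = k + 1 ∧
        ¬ y.output.isSome ∧ ∃ m, y' = y.add (.recv m)) := by
  constructor
  · rintro ⟨⟨hy, rfl⟩, hxy⟩
    have hc : ¬ Closed (x.trans t) := fun hc => by
      have h1 := View.head_of_closed hc hx
      have h2 := View.head_of_closed (hxy ▸ hc) hy
      rw [hxy, h2] at h1
      simp at h1
    rw [View.trans_add_of_not_closed hc, View.trans_add_of_not_closed (hxy ▸ hc), hxy]
    refine ⟨by simp [Event.tag], ?_, hy, _, rfl⟩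
    rw [List.length_cons, ← hxy, hk.2 hc]
  · rintro ⟨hxy, hlen, hy, m, rfl⟩
    have hc : ¬ Closed (x.trans t) := fun hc => by
      rw [View.trans_add_of_closed hc] at hlen
      have := hk.1
      omega
    have hc' : ¬ Closed (y.trans (!t)) := fun hc' => by
      rw [hxy, View.trans_add_of_closed hc'] at hlen
      have := hk'.1
      omega
    rw [View.trans_add_of_not_closed hc, View.trans_add_of_not_closed hc'] at hxy
    simp only [Event.tag, Bool.not_not, List.cons.injEq, Prod.mk.injEq, true_and] at hxy
    exact ⟨⟨hy, by rw [hxy.1]⟩, hxy.2⟩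

-- The probability of a move depends on the mover's view only, and its effect on the other view is
-- visible in the transcript.
open Classical in
theorem Factors.takeTurn {t : Bool} {k : ℕ} {g : X → Y → ℝ≥0∞}
    {P : PMF (View X W M O × View Y W' M O')} (h : Factors t k g P)
    (π : View X W M O → PMF (W × (M ⊕ O))) :
    Factors t (k + 1) g (P.bind fun c => _root_.takeTurn π c.1 c.2) := by
  obtain ⟨a, b, hP, ha, hb⟩ := h
  -- The factor of a mover that has just acted: the old factor times the probability of the latest
  -- act.
  set new : View X W M O → ℝ≥0∞ := fun x' => if x'.tail.output.isSome then 0 else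
    ∑' s : W × (M ⊕ O), if x' = x'.tail.add (.act s.1 s.2) then π x'.tail s * a x'.tail else 0
    with hnew
  have hnew0 : ∀ x', new x' ≠ 0 → (x'.trans t).length ≤ k + 1 := by
    intro x' hx
    simp only [hnew] at hx
    split_ifs at hx with h1
    · exact absurd rfl hx
    · rw [ne_eq, ENNReal.tsum_eq_zero, not_forall] at hx
      obtain ⟨s, hs⟩ := hx
      split_ifs at hs with h2
      · have h1 := (ha _ (right_ne_zero_of_mul hs)).1
        rw [h2, View.trans_add]
        split_ifs
        · omega
        · simp only [List.length_cons]; omega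
      · exact absurd rfl hs
  -- Length `k + 1` means that the transcript grew in this turn. Otherwise it was closed before: the
  -- mover had terminated and keeps `a`, or the other party had terminated and the mover acts
  -- unheard. A mover that terminated second may have done so earlier or just now, hence the sum.
  refine ⟨fun x' => if (x'.trans t).length = k + 1 then new x' else
      (if x'.output.isSome then a x' else 0) +
        if (x'.trans t).head? = some (!t, none) then new x' else 0,
    fun y' => if (y'.trans (!t)).length = k + 1 then
      (if ¬ y'.tail.output.isSome ∧ ∃ m, y' = y'.tail.add (.recv m) then b y'.tail else 0)
      else if Closed (y'.trans (!t)) then b y' else 0, ?_, ?_, ?_⟩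
  · intro x' y'
    beta_reduce
    rw [bind_takeTurn_apply]
    set T := x'.trans t with hT
    set S := y'.trans (!t) with hS
    have h1 : (if x'.output.isSome then P (x', y') else 0) =
        if T = S ∧ T.length ≠ k + 1 ∧ x'.output.isSome then
          g x'.input y'.input * a x' * b y' else 0 := by
      rw [hP]
      by_cases h0 : a x' = 0
      · simp [h0]
      · have hl : T.length ≠ k + 1 := ((ha _ h0).1.trans_lt (Nat.lt_succ_self k)).ne
        rw [← ite_and]
        congr 1
        exact propext ⟨fun h => ⟨h.2, hl, h.1⟩, fun h => ⟨h.2.2, h.1⟩⟩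
    have h2 : (if x'.tail.output.isSome then 0 else
        ∑' s : W × (M ⊕ O), if x' = x'.tail.add (.act s.1 s.2) then
        π x'.tail s * ((if y'.output.isSome then P (x'.tail, y') else 0) +
          if ¬ y'.tail.output.isSome ∧ y' = y'.tail.add (.recv s.2.getLeft?) then
            P (x'.tail, y'.tail) else 0) else 0) = new x' *
        ((if T = S ∧ T.length ≠ k + 1 ∧ T.head? = some (!t, none) then
            g x'.input y'.input * b y' else 0) +
          if T = S ∧ T.length = k + 1 ∧ ¬ y'.tail.output.isSome ∧
            ∃ m, y' = y'.tail.add (.recv m) then g x'.input y'.input * b y'.tail else 0) := by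
      simp only [hnew]
      by_cases hx : x'.tail.output.isSome
      · simp only [hx, if_true, zero_mul]
      rw [if_neg hx, if_neg hx, ← ENNReal.tsum_mul_right]
      refine tsum_congr fun s => ?_
      by_cases hs : x' = x'.tail.add (.act s.1 s.2)
      swap
      · rw [if_neg hs, if_neg hs, zero_mul]
      rw [if_pos hs, if_pos hs, mul_assoc]
      congr 1
      rw [mul_add, mul_ite, mul_ite, mul_zero, hP, hP]
      by_cases h0 : a x'.tail = 0
      · simp [h0]
      have hk := ha _ h0
      congr 1
      · rw [← ite_and]
        refine if_congr ?_ (by rw [mul_left_comm, mul_assoc]; rfl) rfl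
        rw [hT, hS, trans_eq_iff_of_output (e := .act s.1 s.2) hx hk, ← hs]
      · by_cases h0' : b y'.tail = 0
        · simp [h0']
        rw [← ite_and]
        refine if_congr ?_ (by rw [mul_left_comm, mul_assoc]; rfl) rfl
        rw [hT, hS, trans_eq_iff_of_recv (w := s.1) hx hk (hb _ h0'), ← hs]
    rw [h1, h2]
    by_cases hTS : T = S
    swap
    · simp [hTS]
    rw [← hTS]
    by_cases hk : T.length = k + 1
    · simp only [hk, ne_eq, not_true_eq_false, false_and, and_false, if_false, true_and, if_true,
        zero_add]
      split_ifs <;> ring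
    · simp only [hk, ne_eq, not_false_eq_true, false_and, and_false, if_false, true_and, if_true,
        add_zero]
      have hc1 : x'.output.isSome → Closed T := View.closed_of_output t
      have hc2 : T.head? = some (!t, none) → Closed T := fun h => ⟨_, h⟩
      by_cases e1 : x'.output.isSome <;> by_cases e2 : T.head? = some (!t, none) <;>
        simp only [e1, e2, if_true, if_false, mul_zero, zero_mul, add_zero, zero_add,
          Bool.false_eq_true]
      · rw [if_pos (hc1 e1)]; ring
      · rw [if_pos (hc1 e1)]
      · rw [if_pos (hc2 e2)]; ring
  · intro x' hx
    dsimp only at hx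
    by_cases h1 : (x'.trans t).length = k + 1
    · exact ⟨h1.le, fun _ => h1⟩
    rw [if_neg h1] at hx
    rcases not_and_or.1 (mt add_eq_zero.2 hx) with h2 | h2
    · split_ifs at h2 with h3
      · exact ⟨(ha _ h2).1.trans (Nat.le_succ k),
          fun h => absurd (View.closed_of_output t h3) h⟩
      · exact absurd rfl h2
    · split_ifs at h2 with h3
      · exact ⟨hnew0 _ h2, fun h => absurd ⟨_, h3⟩ h⟩
      · exact absurd rfl h2
  · intro y' hy
    dsimp only at hy
    split_ifs at hy with h1 h2 h3
    · exact ⟨h1.le, fun _ => h1⟩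
    · exact absurd rfl hy
    · exact ⟨(hb _ hy).1.trans (Nat.le_succ k), fun h => absurd h3 h⟩
    · exact absurd rfl hy

end Transcript

/-! ### Final views -/

namespace Protocol

variable {X Y U V : Type}

theorem factors_run (P : Protocol X Y U V) (p : PMF (X × Y)) (n : ℕ) :
    Factors true (2 * n) (fun x y => p (x, y)) (P.run p n) := by
  classical
  induction n with
  | zero =>
    refine ⟨fun x => if x.events = [] then 1 else 0, fun y => if y.events = [] then 1 else 0,
      ?_, ?_, ?_⟩
    · rintro ⟨x, l⟩ ⟨y, l'⟩
      simp only [run, PMF.map_apply, Prod.mk.injEq, View.mk.injEq]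
      by_cases h : l = [] ∧ l' = []
      · obtain ⟨rfl, rfl⟩ := h
        rw [tsum_eq_single (x, y) fun c hc => ?_]
        · simp [View.trans, transcript]
        · rw [if_neg]
          rintro ⟨⟨rfl, -⟩, ⟨rfl, -⟩⟩
          exact hc rfl
      · rw [ENNReal.tsum_eq_zero.2 fun c => if_neg fun h' => h ⟨h'.1.2, h'.2.2⟩]
        rcases not_and_or.1 h with h | h <;> simp [h]
    · rintro ⟨x, l⟩ h
      have : l = [] := by by_contra h'; simp [h'] at h
      subst this
      exact ⟨le_rfl, fun _ => rfl⟩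
    · rintro ⟨x, l⟩ h
      have : l = [] := by by_contra h'; simp [h'] at h
      subst this
      exact ⟨le_rfl, fun _ => rfl⟩
  | succ n ih =>
    -- Swapping the parties lets the same one-turn lemma serve Bob; a round is two turns, hence `2 *
    -- n`.
    have h := ((ih.takeTurn P.alice).swap.takeTurn P.bob).swap
    have e : P.run p (n + 1) = ((((P.run p n).bind fun c => takeTurn P.alice c.1 c.2).map
        Prod.swap).bind fun c => takeTurn P.bob c.1 c.2).map Prod.swap := by
      rw [PMF.bind_map, PMF.map_bind, PMF.bind_bind]
      rfl
    rw [e]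
    exact h

/-- A halted pair of views is a fixed point of a round, so its mass can only grow. -/
theorem run_le_run_succ (P : Protocol X Y U V) (p : PMF (X × Y)) {c : P.ViewA × P.ViewB}
    (hc : P.Halted c) (n : ℕ) : P.run p n c ≤ P.run p (n + 1) c := by
  have h : P.round c = PMF.pure c := by
    obtain ⟨a, b⟩ := c
    obtain ⟨ha, hb⟩ := hc
    simp only at ha hb
    simp [round, takeTurn, ha, hb, PMF.pure_map]
  rw [run, PMF.bind_apply]
  refine le_trans ?_ (ENNReal.le_tsum c)
  rw [h, PMF.pure_apply, if_pos rfl, mul_one]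

theorem tendsto_run_finalMass (P : Protocol X Y U V) (p : PMF (X × Y)) {c : P.ViewA × P.ViewB}
    (hc : P.Halted c) :
    Filter.Tendsto (fun n => P.run p n c) Filter.atTop (nhds (P.finalMass p c)) := by
  have h : P.finalMass p c = ⨆ n, P.run p n c := by simp [finalMass, hc]
  rw [h]
  exact tendsto_atTop_iSup (monotone_nat_of_le_succ (P.run_le_run_succ p hc))

theorem halted_of_finalMass_ne_zero (P : Protocol X Y U V) (p : PMF (X × Y))
    {c : P.ViewA × P.ViewB} (hc : P.finalMass p c ≠ 0) :
    P.Halted c ∧ ∃ n, P.run p n c ≠ 0 := by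
  rw [finalMass, ne_eq, ENNReal.iSup_eq_zero, not_forall] at hc
  obtain ⟨n, hn⟩ := hc
  split_ifs at hn with h
  · exact ⟨h, n, hn⟩
  · exact absurd rfl hn

theorem finalViews_ne_zero (P : Protocol X Y U V) (p : PMF (X × Y)) (h : P.Valid p)
    {a : P.ViewA} {b : P.ViewB} (hc : P.finalViews p h (a, b) ≠ 0) :
    P.Halted (a, b) ∧ a.trans true = b.trans false ∧ p (a.input, b.input) ≠ 0 := by
  obtain ⟨h1, n, hn⟩ := P.halted_of_finalMass_ne_zero p hc
  obtain ⟨f, g, hfg, -⟩ := P.factors_run p n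
  rw [hfg] at hn
  split_ifs at hn with h2
  · exact ⟨h1, h2, fun h0 => hn (by simp [h0])⟩
  · exact absurd rfl hn

/-- At each finite stage the factors of the two views cancel and only the set up law remains. Those
factors depend on the stage, so it is the cross-product identity that passes to the limit. -/
theorem finalViews_mul_eq (P : Protocol X Y U V) (p : PMF (X × Y)) (h : P.Valid p)
    {a a' : P.ViewA} {b b' : P.ViewB} (hc : P.Halted (a, b)) (hc' : P.Halted (a', b'))
    (ht : a.trans true = a'.trans true) (ht' : b.trans false = b'.trans false)
    (hp : p (a.input, b.input) * p (a'.input, b'.input) =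
      p (a.input, b'.input) * p (a'.input, b.input)) :
    P.finalViews p h (a, b) * P.finalViews p h (a', b') =
      P.finalViews p h (a, b') * P.finalViews p h (a', b) := by
  have hne : ∀ c, P.finalMass p c ≠ ∞ := fun c => (P.finalViews p h).apply_ne_top c
  have hmul : ∀ {c d}, P.Halted c → P.Halted d → Filter.Tendsto
      (fun n => P.run p n c * P.run p n d) Filter.atTop
      (nhds (P.finalMass p c * P.finalMass p d)) := fun {c d} hc hd =>
    ENNReal.Tendsto.mul (P.tendsto_run_finalMass p hc) (Or.inr (hne d))
      (P.tendsto_run_finalMass p hd) (Or.inr (hne c))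
  refine tendsto_nhds_unique (hmul hc hc')
    (Filter.Tendsto.congr (fun n => ?_) (hmul (c := (a, b')) (d := (a', b)) ⟨hc.1, hc'.2⟩
      ⟨hc'.1, hc.2⟩))
  obtain ⟨f, g, hfg, -⟩ := P.factors_run p n
  have ht₂ : b.trans (!true) = b'.trans (!true) := ht'
  simp only [hfg]
  by_cases e : a'.trans true = b'.trans (!true)
  · rw [if_pos (ht.trans e), if_pos (e.trans ht₂.symm), if_pos (ht.trans (e.trans ht₂.symm)),
      if_pos e]
    calc _ = p (a.input, b'.input) * p (a'.input, b.input) * (f a * f a' * g b * g b') := by ring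
      _ = _ := by rw [← hp]; ring
  -- If the transcripts disagree, both products vanish.
  · rw [if_neg fun h => e (ht.symm.trans h), if_neg e, zero_mul, mul_zero]

end Protocol

/-! ### The laws of oblivious transfer -/

/-- The shares are consistent with each other. -/
def OTPairShare.Consistent {L : ℕ} (x y : OTPairShare L) : Prop :=
  x.sent y.got.1 = y.got.2 ∧ y.sent x.got.1 = x.got.2

instance {L : ℕ} (x y : OTPairShare L) : Decidable (x.Consistent y) :=
  inferInstanceAs (Decidable (_ ∧ _))

/-- The probability of every consistent pair of shares. -/
noncomputable def otPairMass (L : ℕ) : ℝ≥0∞ :=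
  (Fintype.card ((Fin 2 × Fin 2) × ((Fin 2 → BitString L) × (Fin 2 → BitString L))) : ℝ≥0∞)⁻¹

/-- A pair of shares contains both choices and all strings, so a consistent pair comes from exactly
one sample. -/
theorem otPair_apply {L : ℕ} (x y : OTPairShare L) :
    otPair L (x, y) = if x.Consistent y then otPairMass L else 0 := by
  classical
  rw [otPair, PMF.map_apply]
  simp only [PMF.uniformOfFintype_apply, Prod.mk.injEq]
  by_cases h : x.Consistent y
  · rw [tsum_eq_single ((x.1, y.1), (x.sent, y.sent)) fun ω hω => ?_]
    · rw [if_pos h, if_pos]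
      · rfl
      · exact ⟨Prod.ext rfl (Prod.ext rfl h.2.symm), Prod.ext rfl (Prod.ext rfl h.1.symm)⟩
    · rw [if_neg]
      rintro ⟨rfl, rfl⟩
      exact hω rfl
  · rw [if_neg h]
    refine ENNReal.tsum_eq_zero.2 fun ω => if_neg ?_
    rintro ⟨rfl, rfl⟩
    exact h ⟨rfl, rfl⟩

theorem copies_apply {X Y : Type} [Fintype X] [Fintype Y] (p : PMF (X × Y)) {n : ℕ}
    (x : Fin n → X) (y : Fin n → Y) : copies p n (x, y) = ∏ i, p (x i, y i) := by
  classical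
  rw [copies, PMF.map_apply, tsum_eq_single (fun i => (x i, y i)) fun f hf => ?_]
  · simp [iidPMF]
  · rw [if_neg]
    intro h
    simp only [Prod.mk.injEq] at h
    refine hf ?_
    funext i
    exact Prod.ext (congrFun h.1 i).symm (congrFun h.2 i).symm

theorem copies_otPair_apply {L n : ℕ} (x y : Fin n → OTPairShare L) :
    copies (otPair L) n (x, y) =
      if ∀ i, (x i).Consistent (y i) then otPairMass L ^ n else 0 := by
  rw [copies_apply]
  simp only [otPair_apply]
  split_ifs with h
  · simp [h]
  · push Not at h
    obtain ⟨i, hi⟩ := h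
    exact Finset.prod_eq_zero (Finset.mem_univ i) (if_neg hi)

theorem otPairMass_one : otPairMass 1 = (64 : ℝ≥0∞)⁻¹ := by
  simp [otPairMass]

/-- Given one share, the other retains two free bits: its choice, and the string that was not chosen
from it. -/
theorem card_consistent (x : OTPairShare 1) :
    (Finset.univ.filter fun y : OTPairShare 1 => x.Consistent y).card = 4 := by
  revert x
  decide +kernel

theorem sum_otPair_one (x : OTPairShare 1) : ∑ y, (otPair 1 (x, y)).toReal = 1 / 16 := by
  simp only [otPair_apply, otPairMass_one]
  simp only [apply_ite ENNReal.toReal, ENNReal.toReal_zero, ← Finset.sum_filter, Finset.sum_const,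
    card_consistent]
  simp
  norm_num

theorem sum_copies_otPair_one {n : ℕ} (x : Fin n → OTPairShare 1) :
    ∑ y, (copies (otPair 1) n (x, y)).toReal = (1 / 16) ^ n := by
  classical
  simp only [copies_apply, ENNReal.toReal_prod]
  have h := Finset.prod_univ_sum (fun _ : Fin n => (Finset.univ : Finset (OTPairShare 1)))
    (fun i y => (otPair 1 (x i, y)).toReal)
  rw [Fintype.piFinset_univ] at h
  rw [← h]
  simp [sum_otPair_one]

theorem OTPairShare.Consistent.symm {L : ℕ} {x y : OTPairShare L} (h : x.Consistent y) :
    y.Consistent x := ⟨h.2, h.1⟩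

theorem copies_otPair_symm {L n : ℕ} (x y : Fin n → OTPairShare L) :
    copies (otPair L) n (x, y) = copies (otPair L) n (y, x) := by
  rw [copies_otPair_apply, copies_otPair_apply]
  exact if_congr ⟨fun h i => (h i).symm, fun h i => (h i).symm⟩ rfl rfl

theorem failCount_eq_zero {n : ℕ} {u v : Fin n → OTPairShare 1}
    (h : copies (otPair 1) n (u, v) ≠ 0) : failCount u v = 0 := by
  rw [copies_otPair_apply] at h
  split_ifs at h with hc
  · refine Finset.sum_eq_zero fun i _ => ?_
    rw [if_neg (not_not.2 (hc i).1), if_neg (not_not.2 (hc i).2), add_zero]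
  · exact absurd rfl h

/-! ### The set up splits into independent parts -/

/-- What both parties would know about the set up if the choices were public, from the share of
one party and the choices of the other: both choices and both strings received. -/
def OTPairShare.reveal {L : ℕ} (x : OTPairShare L) (c : Fin 2) :
    (Fin 2 × Fin 2) × (BitString L × BitString L) := ((x.1, c), (x.2.2, x.sent c))

/-- The common part of the views of Alice and of Bob, as a function of the view of Alice and of
the choices of Bob. -/
noncomputable def commonA {L n : ℕ} {W M O : Type} (a : View (Fin n → OTPairShare L) W M O)
    (c : Fin n → Fin 2) : List (Bool × Option M) ×
      (Fin n → (Fin 2 × Fin 2) × (BitString L × BitString L)) :=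
  (a.trans true, fun i => (a.input i).reveal (c i))

/-- The common part of the views, as a function of the view of Bob and of the choices of Alice. -/
noncomputable def commonB {L n : ℕ} {W M O : Type} (b : View (Fin n → OTPairShare L) W M O)
    (c : Fin n → Fin 2) : List (Bool × Option M) ×
      (Fin n → (Fin 2 × Fin 2) × (BitString L × BitString L)) :=
  (b.trans false, fun i => (((b.input i).reveal (c i)).1.swap, ((b.input i).reveal (c i)).2.swap))

/-- The choices in the set up of a party. -/
def View.choices {L n : ℕ} {W M O : Type} (b : View (Fin n → OTPairShare L) W M O) :
    Fin n → Fin 2 := fun i => (b.input i).1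

section Common

variable {L n : ℕ} {U V : Type}
  (P : Protocol (Fin n → OTPairShare L) (Fin n → OTPairShare L) U V)
  (h : P.Valid (copies (otPair L) n))

theorem consistent_of_finalViews_ne_zero {a : P.ViewA} {b : P.ViewB}
    (hc : P.finalViews _ h (a, b) ≠ 0) (i : Fin n) : (a.input i).Consistent (b.input i) := by
  have h1 := (P.finalViews_ne_zero _ h hc).2.2
  rw [copies_otPair_apply] at h1
  by_contra h2
  exact h1 (if_neg fun h3 => h2 (h3 i))

/-- Either party can compute the common part from its own view and the `n` choice bits of the other.
This is what limits the entropy cost to `n` bits per party. -/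
theorem commonA_eq_commonB {a : P.ViewA} {b : P.ViewB} (hc : P.finalViews _ h (a, b) ≠ 0) :
    commonA a b.choices = commonB b a.choices := by
  refine Prod.ext (P.finalViews_ne_zero _ h hc).2.1 ?_
  funext i
  obtain ⟨h1, h2⟩ := consistent_of_finalViews_ne_zero P h hc i
  exact Prod.ext rfl (Prod.ext h2.symm h1)

/-- The shares constrain each other only through choices and received strings. Once these agree,
views can be recombined consistently, and the set up law is constant on consistent pairs; the
transcript is handled by `finalViews_mul_eq`. -/
theorem rankOneOn_commonA :
    RankOneOn (P.finalViews _ h) fun c => commonA c.1 c.2.choices := by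
  intro a b a' b' hc hc' hz
  have hco := consistent_of_finalViews_ne_zero P h hc
  have hco' := consistent_of_finalViews_ne_zero P h hc'
  obtain ⟨hh, ht, -⟩ := P.finalViews_ne_zero _ h hc
  obtain ⟨hh', ht', -⟩ := P.finalViews_ne_zero _ h hc'
  simp only [commonA, Prod.mk.injEq] at hz
  obtain ⟨hza, hzr⟩ := hz
  have hr : ∀ i, (a.input i).1 = (a'.input i).1 ∧ (b.input i).1 = (b'.input i).1 ∧
      (a.input i).2.2 = (a'.input i).2.2 ∧
      (a.input i).sent (b.input i).1 = (a'.input i).sent (b'.input i).1 := fun i => by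
    have := congrFun hzr i
    simp only [OTPairShare.reveal, View.choices, Prod.mk.injEq] at this
    exact ⟨this.1.1, this.1.2, this.2.1, this.2.2⟩
  have hch : b.choices = b'.choices := funext fun i => (hr i).2.1
  refine ⟨by simp only [hch], ?_, ?_⟩
  · simp only [commonA, Prod.mk.injEq]
    rw [hch]
    refine ⟨hza.symm, ?_⟩
    rw [← hzr, hch]
  · refine P.finalViews_mul_eq _ h hh hh' hza (ht.symm.trans (hza.trans ht')) ?_
    have h1 : ∀ i, (a.input i).Consistent (b'.input i) := fun i => by
      obtain ⟨e1, e2, e3, e4⟩ := hr i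
      obtain ⟨f1, f2⟩ := hco i
      obtain ⟨f1', f2'⟩ := hco' i
      refine ⟨?_, ?_⟩
      · change (a.input i).sent (b'.input i).1 = _
        rw [← e2, e4]; exact f1'
      · change (b'.input i).sent (a.input i).1 = (a.input i).2.2
        rw [e1, e3]; exact f2'
    have h2 : ∀ i, (a'.input i).Consistent (b.input i) := fun i => by
      obtain ⟨e1, e2, e3, e4⟩ := hr i
      obtain ⟨f1, f2⟩ := hco i
      obtain ⟨f1', f2'⟩ := hco' i
      refine ⟨?_, ?_⟩
      · change (a'.input i).sent (b.input i).1 = _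
        rw [e2, ← e4]; exact f1
      · change (b.input i).sent (a'.input i).1 = (a'.input i).2.2
        rw [← e1, ← e3]; exact f2
    rw [copies_otPair_apply, copies_otPair_apply, copies_otPair_apply, copies_otPair_apply,
      if_pos hco, if_pos hco', if_pos h1, if_pos h2]

end Common

/-! ### The converse -/

/-- If the pair `(s, o)` is close to a pair simulated from `q`, the cross entropy of `o` given `z`
is at least the conditional entropy of `q`, up to the cost of the side value `κ` that determines
`z` from `s`. -/
theorem le_expect_cross {C S U V Z K : Type} [Fintype U] [Fintype V] [Fintype K] [Nonempty K]
    [Nonempty V] (F : PMF C) (z : C → Z) (s : C → S) (o : C → Option V) (v₀ : V) (κ : C → K)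
    (φ : S → K → Z) (hz : ∀ c, F c ≠ 0 → z c = φ (s c) (κ c)) (q : PMF (U × V)) (sim : U → PMF S)
    {c m ε δ : ℝ} (hc : 0 < c) (hm : 0 < m)
    (hq : ∀ u v, q (u, v) ≠ 0 → (q (u, v)).toReal = c)
    (hsum : ∀ u, ∑ v, (q (u, v)).toReal = m) (hδ₀ : 0 < δ) (hδ : δ < 1)
    (htv : ∀ (f : S → Option V → ℝ) (M : ℝ), (∀ σ v, 0 ≤ f σ v) → (∀ σ v, f σ v ≤ M) →
      expect q (fun uv => expect (sim uv.1) fun σ => ENNReal.ofReal (f σ (some uv.2))) ≤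
        expect F (fun c => ENNReal.ofReal (f (s c) (o c))) + ENNReal.ofReal (2 * M * ε)) :
    ENNReal.ofReal (Real.log (m / c)) ≤
      expect F (fun c => ENNReal.ofReal (-Real.log
        (smooth δ (condLaw F z (fun c => (o c).getD v₀) (z c)) ((o c).getD v₀)))) +
      ENNReal.ofReal (Real.log (Fintype.card K)) +
      ENNReal.ofReal (2 * Real.log (Fintype.card V / δ) * ε) := by
  set r : Z → V → ℝ := fun z₀ => smooth δ (condLaw F z (fun c => (o c).getD v₀) z₀) with hr
  have hcard : (0 : ℝ) < Fintype.card V := by exact_mod_cast Fintype.card_pos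
  have hpos : 0 < δ / Fintype.card V := by positivity
  have hle : ∀ z₀ v, δ / Fintype.card V ≤ r z₀ v := fun z₀ v =>
    le_smooth hδ (condLaw_nonneg F z _ z₀) v
  have hr1 : ∀ z₀, ∑ v, r z₀ v ≤ 1 := fun z₀ => sum_smooth_le hδ (sum_condLaw_le_one F z _ z₀)
  -- Averaging over the side value gives a reference law that depends on `s` alone, so that the
  -- closeness to the simulation can be used.
  set a : S → V → ℝ := fun σ => average fun k => r (φ σ k) with ha
  have hale : ∀ σ v, δ / Fintype.card V ≤ a σ v := fun σ v => le_average fun k => hle _ v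
  have ha1 : ∀ σ, ∑ v, a σ v ≤ 1 := fun σ => average_le_one_of_sum_le fun k => hr1 _
  have ha0 : ∀ σ v, 0 < a σ v := fun σ v => hpos.trans_le (hale σ v)
  have h1 := le_expect_bind_sim q hc hm hq hsum sim ha0 ha1
  have h2 := htv (fun σ v => -Real.log (a σ (v.getD v₀))) (Real.log (Fintype.card V / δ))
    (fun σ v => by
      have h3 := Finset.single_le_sum (f := a σ) (fun w _ => (ha0 σ w).le)
        (Finset.mem_univ (v.getD v₀))
      have := Real.log_nonpos (ha0 σ (v.getD v₀)).le (h3.trans (ha1 σ))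
      linarith)
    (fun σ v => by
      have h3 := Real.log_le_log hpos (hale σ (v.getD v₀))
      rw [Real.log_div hδ₀.ne' hcard.ne'] at h3
      rw [Real.log_div hcard.ne' hδ₀.ne']
      linarith)
  have h3 := expect_average_le F z (fun c => (o c).getD v₀) s κ φ hz (r := r)
    fun z₀ v => hpos.trans_le (hle z₀ v)
  exact h1.trans (h2.trans (add_le_add h3 le_rfl))

theorem expect_bind_map_sim {U V S R : Type} (q : PMF (U × V)) (k : U × V → PMF S)
    (g : U × V → S → R) (f : R → ℝ≥0∞) :
    expect (q.bind fun uv => (k uv).map (g uv)) f =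
      expect q fun uv => expect (k uv) fun σ => f (g uv σ) := by
  rw [expect_bind]
  simp only [expect_map]
  rfl

/-- Two lower bounds from `le_expect_cross`, one for each party's output, against the upper bound
from conditional independence. The expected failure count is small for the real outputs because it
is zero for the ideal pair. -/
theorem CanSample.bound {L n₁ n₂ : ℕ} {ε K d δ : ℝ}
    (hK : ∀ a ∈ stdSimplex ℝ (Fin 2 → BitString 1), ∀ b ∈ stdSimplex ℝ (Fin 2 × BitString 1),
      ent a + ent b ≤ Real.log 2 + d + K * otError a b) (hK0 : 0 ≤ K) (hd : 0 ≤ d)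
    (hε : 0 ≤ ε) (hδ₀ : 0 < δ) (hδ : δ < 1)
    (h : CanSample (otPair L) (otPair 1) ε n₁ n₂) :
    4 * n₁ * Real.log 2 ≤ n₁ * (2 * (Real.log 2 + d)) - 2 * Real.log (1 - δ) +
      2 * (n₁ * (2 * (Real.log 2 + d)) - 2 * Real.log (1 - δ) + K * (2 * n₁)) * ε +
      2 * (n₂ * Real.log 2) + 2 * (2 * (n₁ * (4 * Real.log 2) - Real.log δ) * ε) := by
  obtain ⟨P, hV, simA, simB, h1, h2, h3⟩ := h
  set F := P.finalViews _ hV with hF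
  set q := copies (otPair 1) n₁ with hq
  -- A default for missing outputs; its value plays no role.
  set v₀ : Fin n₁ → OTPairShare 1 := fun _ => default with hv₀
  set E : ℝ := n₁ * (2 * (Real.log 2 + d)) with hE
  have hl2 : 0 < Real.log 2 := Real.log_pos (by norm_num)
  have hE0 : 0 ≤ E := by positivity
  have hlog : 0 ≤ -Real.log (1 - δ) := by
    have := Real.log_nonpos (by linarith : 0 ≤ 1 - δ) (by linarith)
    linarith
  have hlogδ : 0 ≤ -Real.log δ := by
    have := Real.log_nonpos hδ₀.le hδ.le
    linarith
  have hcardV : (Fintype.card (Fin n₁ → OTPairShare 1) : ℝ) = 16 ^ n₁ := by simp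
  have hcardK : Real.log (Fintype.card (Fin n₂ → Fin 2)) = n₂ * Real.log 2 := by
    simp
  have hlogV : Real.log (Fintype.card (Fin n₁ → OTPairShare 1) / δ) =
      n₁ * (4 * Real.log 2) - Real.log δ := by
    rw [hcardV, Real.log_div (by positivity) hδ₀.ne', Real.log_pow,
      show (16 : ℝ) = 2 ^ 4 by norm_num, Real.log_pow]
    norm_num
  have hc : (0 : ℝ) < (1 / 64) ^ n₁ := by positivity
  have hm : (0 : ℝ) < (1 / 16) ^ n₁ := by positivity
  -- Conditional entropy of one share given the other: two bits per copy.
  have hmc : Real.log ((1 / 16 : ℝ) ^ n₁ / (1 / 64) ^ n₁) = 2 * n₁ * Real.log 2 := by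
    rw [← div_pow, Real.log_pow, show (1 / 16 : ℝ) / (1 / 64) = 2 ^ 2 by norm_num, Real.log_pow]
    push_cast
    ring
  have hq1 : ∀ u v, q (u, v) ≠ 0 → (q (u, v)).toReal = (1 / 64) ^ n₁ := by
    intro u v h0
    rw [hq, copies_otPair_apply] at h0 ⊢
    split_ifs at h0 ⊢ with hcon
    · rw [otPairMass_one]; simp
    · exact absurd rfl h0
  have hswap : ∀ u v, (q.map Prod.swap) (v, u) = q (v, u) := fun u v => by
    rw [map_swap_apply]; exact copies_otPair_symm _ _
  -- Alice's side
  have hA := le_expect_cross F (fun c => commonA c.1 c.2.choices) (fun c => c.1)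
    (fun c => c.2.output) v₀ (fun c => c.2.choices) commonA (fun c _ => rfl) q simA hc hm hq1
    (fun u => sum_copies_otPair_one u) hδ₀ hδ (ε := ε) (fun f M hf hM => by
      have := expect_le_of_tvDist_le h2 (f := fun x => f x.1 x.2) (fun x => hf _ _)
        (fun x => hM _ _)
      rwa [expect_bind_map_sim, expect_map] at this)
  -- Bob's side, with the law of the pair swapped. Here the common part is read off as `commonB`,
  -- which agrees with `commonA` only on the support.
  have hB := le_expect_cross F (fun c => commonA c.1 c.2.choices) (fun c => c.2)
    (fun c => c.1.output) v₀ (fun c => c.1.choices) commonB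
    (fun c hc => commonA_eq_commonB P hV hc) (q.map Prod.swap) simB hc hm
    (fun u v h0 => by rw [hswap] at h0 ⊢; exact hq1 u v h0)
    (fun u => by simp only [hswap]; exact sum_copies_otPair_one u) hδ₀ hδ (ε := ε)
    (fun f M hf hM => by
      have := expect_le_of_tvDist_le h3 (f := fun x => f x.2 x.1) (fun x => hf _ _)
        (fun x => hM _ _)
      rw [expect_bind_map_sim, expect_map] at this
      rwa [expect_map])
  have hup := (rankOneOn_commonA P hV).expect_cross_add_le (fun a => a.output.getD v₀)
    (fun b => b.output.getD v₀) hδ₀ hδ hE0 (N := fun u v => K * failCount u v)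
    (fun u v => mul_nonneg hK0 (failCount_nonneg u v))
    (fun a ha b hb => by
      have := ent_add_ent_le_of_otError_le hK ha hb
      rw [Finset.mul_sum] at this
      simp only [Finset.mul_sum] at this
      refine this.trans_eq ?_
      congr 1
      exact Finset.sum_congr rfl fun u _ => Finset.sum_congr rfl fun v _ => by ring)
  -- The closeness of the outputs transfers the upper bound, failure count included, to the ideal
  -- pair, where no OT fails.
  have htv := expect_le_of_tvDist_le ((tvDist_comm _ _).trans_le h1)
    (f := fun x => E - 2 * Real.log (1 - δ) + K * failCount (x.1.getD v₀) (x.2.getD v₀))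
    (M := E - 2 * Real.log (1 - δ) + K * (2 * n₁))
    (fun x => by have := mul_nonneg hK0 (failCount_nonneg (x.1.getD v₀) (x.2.getD v₀)); linarith)
    (fun x => by
      have := mul_le_mul_of_nonneg_left (failCount_le (x.1.getD v₀) (x.2.getD v₀)) hK0
      linarith)
  rw [expect_map, expect_map] at htv
  have hid : expect q ((fun x : Option (Fin n₁ → OTPairShare 1) × Option (Fin n₁ → OTPairShare 1) =>
      ENNReal.ofReal (E - 2 * Real.log (1 - δ) + K * failCount (x.1.getD v₀) (x.2.getD v₀))) ∘
      fun uv => (some uv.1, some uv.2)) ≤ ENNReal.ofReal (E - 2 * Real.log (1 - δ)) := by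
    rw [← expect_const q (ENNReal.ofReal (E - 2 * Real.log (1 - δ)))]
    refine expect_mono q fun uv huv => ?_
    simp only [Function.comp, Option.getD_some]
    rw [failCount_eq_zero (u := uv.1) (v := uv.2) huv, mul_zero, add_zero]
  rw [hmc, hcardK, hlogV] at hA hB
  have htot := (add_le_add hA hB).trans_eq (by
    rw [add_add_add_comm, add_add_add_comm (expect _ _), add_comm (expect F _) (expect F _)])
  have hfin := htot.trans (add_le_add (add_le_add (hup.trans (htv.trans (add_le_add hid le_rfl)))
    le_rfl) le_rfl)
  have hp1 : 0 ≤ n₁ * (4 * Real.log 2) - Real.log δ := by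
    have : 0 ≤ n₁ * (4 * Real.log 2) := by positivity
    linarith
  have hp2 : 0 ≤ 2 * (n₁ * (4 * Real.log 2) - Real.log δ) * ε :=
    mul_nonneg (mul_nonneg (by norm_num) hp1) hε
  have hp3 : 0 ≤ E - 2 * Real.log (1 - δ) := by linarith
  have hp4 : 0 ≤ 2 * (E - 2 * Real.log (1 - δ) + K * (2 * n₁)) * ε :=
    mul_nonneg (mul_nonneg (by norm_num) (add_nonneg hp3 (by positivity))) hε
  have hp5 : 0 ≤ n₂ * Real.log 2 := by positivity
  rw [← ENNReal.ofReal_add (by positivity) (by positivity), ← ENNReal.ofReal_add hp3 hp4,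
    ← ENNReal.ofReal_add hp5 hp5, ← ENNReal.ofReal_add hp2 hp2,
    ← ENNReal.ofReal_add (add_nonneg hp3 hp4) (add_nonneg hp5 hp5),
    ← ENNReal.ofReal_add (add_nonneg (add_nonneg hp3 hp4) (add_nonneg hp5 hp5))
      (add_nonneg hp2 hp2)] at hfin
  have := (ENNReal.ofReal_le_ofReal_iff (add_nonneg (add_nonneg (add_nonneg hp3 hp4)
    (add_nonneg hp5 hp5)) (add_nonneg hp2 hp2))).1 hfin
  linarith

/-- Rates above `1` cannot be achieved with small errors. -/
theorem exists_forall_canSample_le (L : ℕ) {θ : ℝ} (hθ : 0 < θ) :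
    ∃ ε₀ > 0, ∀ ε : ℝ, 0 < ε → ε < ε₀ → ∀ n₁ n₂ : ℕ, 0 < n₁ →
      CanSample (otPair L) (otPair 1) ε n₁ n₂ → n₁ * (1 - θ) ≤ n₂ := by
  have hl : 0 < Real.log 2 := Real.log_pos (by norm_num)
  -- The total slack is `2 n₁ θ log 2`: a quarter is spent on `d`, a quarter on smoothing, by taking
  -- `log (1 - δ) = -d`, and half on the error `ε`.
  set d : ℝ := Real.log 2 * θ / 4 with hd
  have hd0 : 0 < d := by positivity
  obtain ⟨K, hK0, hK⟩ := exists_ent_add_ent_le card_bitString_one hd0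
  set δ : ℝ := 1 - Real.exp (-d) with hδ
  have hδ₀ : 0 < δ := by
    have : Real.exp (-d) < 1 := by
      rw [← Real.exp_zero]; exact Real.exp_lt_exp.2 (by linarith)
    linarith
  have hδ₁ : δ < 1 := by
    have := Real.exp_pos (-d)
    linarith
  have hlog : Real.log (1 - δ) = -d := by rw [hδ, sub_sub_cancel, Real.log_exp]
  have hlogδ : 0 ≤ -Real.log δ := by
    have := Real.log_nonpos hδ₀.le hδ₁.le
    linarith
  -- An upper bound per copy for the coefficient of `ε`; `n₁ ≥ 1` absorbs the terms that do not grow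
  -- with `n₁`.
  set R : ℝ := 2 * (2 * (Real.log 2 + d) + 2 * d + K * 2) +
    4 * (4 * Real.log 2 - Real.log δ) with hR
  have hR0 : 0 < R := by
    have : 0 ≤ K * 2 := by positivity
    linarith
  refine ⟨Real.log 2 * θ / R, by positivity, fun ε hε hεR n₁ n₂ hn h => ?_⟩
  have hb := h.bound hK hK0 hd0.le hε.le hδ₀ hδ₁
  rw [hlog] at hb
  have hn1 : (1 : ℝ) ≤ n₁ := by exact_mod_cast hn
  have h1 : ε * R ≤ Real.log 2 * θ := by
    rw [lt_div_iff₀ hR0] at hεR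
    exact hεR.le
  have h2 : 2 * d ≤ n₁ * (2 * d) := le_mul_of_one_le_left (by positivity) hn1
  have h3 : 2 * (n₁ * (2 * (Real.log 2 + d)) - 2 * -d + K * (2 * n₁)) * ε +
      2 * (2 * (n₁ * (4 * Real.log 2) - Real.log δ) * ε) ≤ n₁ * (ε * R) := by
    have h4 : -Real.log δ ≤ n₁ * (-Real.log δ) := le_mul_of_one_le_left hlogδ hn1
    have h5 := mul_le_mul_of_nonneg_right h4 hε.le
    have h6 := mul_le_mul_of_nonneg_right h2 hε.le
    rw [hR]
    nlinarith
  have h4 : n₁ * (ε * R) ≤ n₁ * (Real.log 2 * θ) := mul_le_mul_of_nonneg_left h1 (by positivity)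
  have h5 : n₁ * (2 * d) = n₁ * (Real.log 2 * θ) / 2 := by rw [hd]; ring
  have h6 : 2 * Real.log 2 * (n₁ * (1 - θ)) ≤ 2 * Real.log 2 * n₂ := by
    nlinarith
  exact le_of_mul_le_mul_left h6 (by positivity)

/-! ### Sampling without communication -/

namespace Protocol

variable {X Y U V : Type}

/-- Both parties output a function of their part of the set up. -/
noncomputable def localProtocol (f : X → U) (g : Y → V) : Protocol X Y U V where
  StateA := Unit
  StateB := Unit
  Msg := Unit
  alice v := PMF.pure ((), .inr (f v.input))
  bob v := PMF.pure ((), .inr (g v.input))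

/-- Alice's final view in `localProtocol`. -/
def localViewA (f : X → U) (g : Y → V) (x : X) : (localProtocol f g).ViewA :=
  ⟨x, [.act () (.inr (f x))]⟩

/-- Bob's final view in `localProtocol`. -/
def localViewB (f : X → U) (g : Y → V) (y : Y) : (localProtocol f g).ViewB :=
  ⟨y, [.act () (.inr (g y)), .recv none]⟩

variable (f : X → U) (g : Y → V)

theorem localViewA_output (x : X) : (localViewA f g x).output = some (f x) := rfl

theorem localViewB_output (y : Y) : (localViewB f g y).output = some (g y) := rfl

theorem run_localProtocol (p : PMF (X × Y)) (n : ℕ) :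
    (localProtocol f g).run p (n + 1) =
      p.map fun xy => (localViewA f g xy.1, localViewB f g xy.2) := by
  induction n with
  | zero =>
    rw [run, run, PMF.bind_map, ← PMF.bind_pure_comp]
    congr 1
    funext xy
    simp [round, takeTurn, localProtocol, View.output, PMF.pure_map, View.receive, View.add,
      Event.output, localViewA, localViewB]
  | succ n ih =>
    rw [run, ih, PMF.bind_map, ← PMF.bind_pure_comp]
    congr 1
    funext xy
    simp [round, takeTurn, localViewA_output, localViewB_output, PMF.pure_map]

theorem finalMass_localProtocol (p : PMF (X × Y)) (c) :
    (localProtocol f g).finalMass p c =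
      (p.map fun xy => (localViewA f g xy.1, localViewB f g xy.2)) c := by
  by_cases hc : (localProtocol f g).Halted c
  · refine tendsto_nhds_unique ((localProtocol f g).tendsto_run_finalMass p hc) ?_
    rw [← Filter.tendsto_add_atTop_iff_nat 1]
    simp only [run_localProtocol]
    exact tendsto_const_nhds
  · simp only [finalMass, if_neg hc, ciSup_const]
    symm
    rw [PMF.apply_eq_zero_iff, PMF.support_map]
    rintro ⟨xy, -, rfl⟩
    exact hc ⟨rfl, rfl⟩

theorem valid_localProtocol (p : PMF (X × Y)) : (localProtocol f g).Valid p := by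
  simp only [Valid, finalMass_localProtocol]
  exact PMF.tsum_coe _

theorem finalViews_localProtocol (p : PMF (X × Y)) (h) :
    (localProtocol f g).finalViews p h =
      p.map fun xy => (localViewA f g xy.1, localViewB f g xy.2) :=
  PMF.ext fun c => finalMass_localProtocol f g p c

/-- If the set up extends `(U, V)` by independent randomness, it samples `(U, V)` perfectly. -/
theorem securelySamples_localProtocol {R : Type} {p : PMF (X × Y)} {q : PMF (U × V)} {ρ : PMF R}
    {a : U → R → X} {b : V → R → Y}
    (hp : p = q.bind fun uv => ρ.map fun r => (a uv.1 r, b uv.2 r))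
    (ha : ∀ u r, f (a u r) = u) (hb : ∀ v r, g (b v r) = v) {ε : ℝ} (hε : 0 ≤ ε) :
    (localProtocol f g).SecurelySamples ε p q := by
  subst hp
  -- Each simulator resamples the extra randomness, which is independent of the pair, and runs its
  -- party's side.
  refine ⟨valid_localProtocol f g _, fun u => ρ.map fun r => localViewA f g (a u r),
    fun v => ρ.map fun r => localViewB f g (b v r), ?_, ?_, ?_⟩
  all_goals
    refine le_of_eq_of_le ?_ hε
    rw [← tvDist_self]
    congr 1
    rw [finalViews_localProtocol]
    simp only [PMF.map_bind, PMF.map_comp]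
  · rw [← PMF.bind_pure_comp]
    congr 1
    funext uv
    simp only [Function.comp_def, localViewA_output, localViewB_output, ha, hb]
    exact PMF.map_const ρ _
  · simp only [Function.comp_def, localViewB_output, hb]
  · simp only [Function.comp_def, localViewA_output, ha]

end Protocol

/-! ### Splitting the first bit off every string -/

section Extend

variable {L : ℕ}

/-- A bit followed by a string. -/
def consBit (b : BitString 1) (s : BitString L) : BitString (L + 1) := Fin.cons (b 0) s

/-- The first bit of a string. -/
def headBit (s : BitString (L + 1)) : BitString 1 := fun _ => s 0

theorem headBit_consBit (b : BitString 1) (s : BitString L) : headBit (consBit b s) = b := by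
  funext i
  rw [Subsingleton.elim i 0]
  rfl

theorem tail_consBit (b : BitString 1) (s : BitString L) : Fin.tail (consBit b s) = s := rfl

theorem consBit_headBit (s : BitString (L + 1)) : consBit (headBit s) (Fin.tail s) = s :=
  Fin.cons_self_tail s

/-- The sample space of a pair of opposite string-OTs. -/
abbrev OTSpace (L : ℕ) : Type :=
  (Fin 2 × Fin 2) × ((Fin 2 → BitString L) × (Fin 2 → BitString L))

/-- The strings of both parties. -/
abbrev OTStrings (L : ℕ) : Type := (Fin 2 → BitString L) × (Fin 2 → BitString L)

/-- Prolong all strings of a sample. -/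
def extendSpace : OTSpace 1 × OTStrings L ≃ OTSpace (L + 1) where
  toFun ω := (ω.1.1, (fun j => consBit (ω.1.2.1 j) (ω.2.1 j), fun j => consBit (ω.1.2.2 j) (ω.2.2 j)))
  invFun ω := ((ω.1, (fun j => headBit (ω.2.1 j), fun j => headBit (ω.2.2 j))),
    (fun j => Fin.tail (ω.2.1 j), fun j => Fin.tail (ω.2.2 j)))
  left_inv ω := by simp only [headBit_consBit, tail_consBit]
  right_inv ω := by simp only [consBit_headBit]

theorem map_equiv_uniformOfFintype {α β : Type} [Fintype α] [Nonempty α] [Fintype β] [Nonempty β]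
    (e : α ≃ β) : (PMF.uniformOfFintype α).map e = PMF.uniformOfFintype β := by
  classical
  ext b
  rw [PMF.map_apply, tsum_eq_single (e.symm b) fun a ha => ?_]
  · simp [Fintype.card_congr e]
  · rw [if_neg]
    rintro rfl
    simp at ha

theorem bind_uniformOfFintype {α β : Type} [Fintype α] [Nonempty α] [Fintype β] [Nonempty β] :
    ((PMF.uniformOfFintype α).bind fun a => (PMF.uniformOfFintype β).map fun b => (a, b)) =
      PMF.uniformOfFintype (α × β) := by
  classical
  ext ⟨a, b⟩
  rw [PMF.bind_apply, tsum_eq_single a fun a' ha => ?_]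
  · rw [PMF.map_apply, tsum_eq_single b fun b' hb => ?_]
    · simp only [if_true, PMF.uniformOfFintype_apply, Fintype.card_prod, Nat.cast_mul]
      rw [ENNReal.mul_inv (Or.inr (ENNReal.natCast_ne_top _)) (Or.inl (ENNReal.natCast_ne_top _))]
    · rw [if_neg]
      simp [Ne.symm hb]
  · rw [mul_eq_zero]
    right
    rw [PMF.map_apply]
    refine ENNReal.tsum_eq_zero.2 fun b' => if_neg ?_
    simp [Ne.symm ha]

/-- Prolong the strings of Alice's share. -/
def extendA (u : OTPairShare 1) (r : OTStrings L) : OTPairShare (L + 1) :=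
  (u.1, fun j => consBit (u.sent j) (r.1 j), consBit u.2.2 (r.2 u.1))

/-- Prolong the strings of Bob's share. -/
def extendB (v : OTPairShare 1) (r : OTStrings L) : OTPairShare (L + 1) :=
  (v.1, fun j => consBit (v.sent j) (r.2 j), consBit v.2.2 (r.1 v.1))

/-- Keep the first bit of each string. -/
def OTPairShare.head (u : OTPairShare (L + 1)) : OTPairShare 1 :=
  (u.1, fun j => headBit (u.sent j), headBit u.2.2)

theorem head_extendA (u : OTPairShare 1) (r : OTStrings L) : (extendA u r).head = u :=
  Prod.ext rfl (Prod.ext (funext fun j => headBit_consBit (u.2.1 j) (r.1 j)) (headBit_consBit u.2.2 (r.2 u.1)))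

theorem head_extendB (u : OTPairShare 1) (r : OTStrings L) : (extendB u r).head = u :=
  Prod.ext rfl (Prod.ext (funext fun j => headBit_consBit (u.2.1 j) (r.2 j)) (headBit_consBit u.2.2 (r.1 u.1)))

/-- The appended bits are independent of choices and first bits, and each party's extension depends
only on its own share and these bits. -/
theorem otPair_succ : otPair (L + 1) = (otPair 1).bind fun uv =>
    (PMF.uniformOfFintype (OTStrings L)).map fun r => (extendA uv.1 r, extendB uv.2 r) := by
  have h : PMF.uniformOfFintype (OTSpace (L + 1)) = ((PMF.uniformOfFintype (OTSpace 1)).bind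
      fun a => (PMF.uniformOfFintype (OTStrings L)).map fun b => (a, b)).map extendSpace := by
    rw [bind_uniformOfFintype, map_equiv_uniformOfFintype]
  rw [otPair, h, otPair, PMF.bind_map, PMF.map_bind, PMF.map_bind]
  simp only [PMF.map_comp]
  rfl

theorem copies_one {X Y : Type} [Fintype X] [Fintype Y] (p : PMF (X × Y)) :
    copies p 1 = p.map fun xy => (fun _ => xy.1, fun _ => xy.2) := by
  classical
  ext ⟨x, y⟩
  rw [copies_apply, PMF.map_apply, tsum_eq_single (x 0, y 0) fun c hc => ?_]
  · rw [if_pos]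
    · simp
    · refine Prod.ext ?_ ?_ <;> funext i <;> rw [Subsingleton.elim i 0]
  · rw [if_neg]
    rintro h
    simp only [Prod.mk.injEq] at h
    rw [h.1, h.2] at hc
    exact hc rfl

theorem canSample_one_one (L : ℕ) {ε : ℝ} (hε : 0 ≤ ε) :
    CanSample (otPair (L + 1)) (otPair 1) ε 1 1 := by
  have h : copies (otPair (L + 1)) 1 = (copies (otPair 1) 1).bind fun uv =>
      (PMF.uniformOfFintype (OTStrings L)).map fun r =>
        (fun i => extendA (uv.1 i) r, fun i => extendB (uv.2 i) r) := by
    rw [copies_one, copies_one, otPair_succ, PMF.map_bind, PMF.bind_map]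
    simp only [PMF.map_comp]
    rfl
  exact ⟨_, Protocol.securelySamples_localProtocol (fun x i => (x i).head) (fun y i => (y i).head)
    h (fun u r => funext fun i => head_extendA (u i) r)
    (fun v r => funext fun i => head_extendB (v i) r) hε⟩

end Extend

theorem isStatSamplingRate_otPair {L : ℕ} (hL : 1 ≤ L) :
    IsStatSamplingRate (otPair L) (otPair 1) 1 := by
  obtain ⟨L, rfl⟩ : ∃ l, L = l + 1 := ⟨L - 1, by omega⟩
  refine ⟨fun ε hε => ⟨1, 1, one_pos, one_pos, canSample_one_one L hε.le⟩, ?_⟩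
  refine tendsto_order.2 ⟨fun a ha => ?_, fun b hb => ?_⟩
  · filter_upwards [self_mem_nhdsWithin] with ε hε
    refine ha.trans_le (le_sSup ⟨1, 1, one_pos, one_pos, canSample_one_one L (le_of_lt hε), ?_⟩)
    simp
  · obtain ⟨r, hr1, hrb⟩ := ENNReal.lt_iff_exists_nnreal_btwn.1 hb
    have hr1' : (1 : ℝ) < r := by exact_mod_cast hr1
    have hr0 : (0 : ℝ) < r := by linarith
    -- With this `θ` the converse reads `n₁ / r ≤ n₂`, for an `r` strictly between `1` and `b`.
    obtain ⟨ε₀, hε₀, h⟩ := exists_forall_canSample_le (L + 1) (θ := 1 - 1 / (r : ℝ))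
      (by rw [sub_pos, div_lt_one hr0]; exact hr1')
    filter_upwards [Ioo_mem_nhdsGT hε₀] with ε hε
    refine lt_of_le_of_lt (sSup_le ?_) hrb
    rintro _ ⟨n₁, n₂, hn₁, hn₂, hs, rfl⟩
    have h1 := h ε hε.1 hε.2 n₁ n₂ hn₁ hs
    rw [sub_sub_cancel, mul_one_div, div_le_iff₀ hr0] at h1
    refine ENNReal.div_le_of_le_mul ?_
    have h2 : (n₁ : NNReal) ≤ r * n₂ := by
      rw [← NNReal.coe_le_coe]
      push_cast
      linarith
    exact_mod_cast h2

/-! ### Shannon entropy -/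

section Shannon

variable {α β C Z W : Type} [Fintype α] [Fintype β]

theorem shannonEntropy_eq_ent (p : PMF α) :
    shannonEntropy p = ent (fun a => (p a).toReal) / Real.log 2 := by
  rw [shannonEntropy, ent, Finset.sum_div]
  refine Finset.sum_congr rfl fun a _ => ?_
  rw [Real.logb, one_div, Real.log_inv, Real.negMulLog]
  ring

theorem shannonEntropy_map_equiv (p : PMF α) (e : α ≃ β) :
    shannonEntropy (p.map e) = shannonEntropy p := by
  classical
  rw [shannonEntropy, shannonEntropy, ← e.sum_comp]
  refine Finset.sum_congr rfl fun a _ => ?_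
  have : (p.map e) (e a) = p a := by
    rw [PMF.map_apply, tsum_eq_single a fun b hb => ?_]
    · simp
    · simp [Ne.symm hb]
  rw [this]

theorem sum_toReal_pmf (p : PMF α) : ∑ a, (p a).toReal = 1 := by
  rw [← ENNReal.toReal_sum fun a _ => p.apply_ne_top a, ← tsum_fintype (L := .unconditional _),
    p.tsum_coe]
  rfl

/-- The entropy of a distribution that is uniform on its support. -/
theorem shannonEntropy_of_uniform {p : PMF α} {c : ℝ} (h : ∀ a, p a ≠ 0 → (p a).toReal = c) :
    shannonEntropy p = Real.logb 2 (1 / c) := by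
  rw [shannonEntropy, ← one_mul (Real.logb 2 (1 / c)), ← sum_toReal_pmf p, Finset.sum_mul]
  refine Finset.sum_congr rfl fun a _ => ?_
  by_cases h0 : p a = 0
  · simp [h0]
  · rw [h a h0]

/-- Fibres of equal size `k` make the image law uniform on its support. -/
theorem shannonEntropy_map_uniform {Ω : Type} [Fintype Ω] [Nonempty Ω] [DecidableEq α] (F : Ω → α)
    {k : ℕ} (h : ∀ ω, (Finset.univ.filter fun ω' => F ω' = F ω).card = k) :
    shannonEntropy ((PMF.uniformOfFintype Ω).map F) = Real.logb 2 (Fintype.card Ω / k) := by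
  rw [shannonEntropy_of_uniform (c := k / Fintype.card Ω), one_div_div]
  intro a ha
  have ha' : a ∈ ((PMF.uniformOfFintype Ω).map F).support := ha
  rw [PMF.mem_support_map_iff] at ha'
  obtain ⟨ω, -, rfl⟩ := ha'
  have h1 : ((PMF.uniformOfFintype Ω).map F) (F ω) = k * (Fintype.card Ω : ℝ≥0∞)⁻¹ := by
    rw [← h ω, PMF.map_apply, tsum_fintype]
    simp only [PMF.uniformOfFintype_apply, eq_comm (a := F ω), ← Finset.sum_filter,
      Finset.sum_const, nsmul_eq_mul]
  rw [h1]
  simp [div_eq_mul_inv]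

/-- The chain rule. -/
theorem ent_map_pair [Fintype Z] [Fintype W] (F : PMF C) (z : C → Z) (w : C → W) :
    ent (fun x => ((F.map fun c => (z c, w c)) x).toReal) =
      ent (fun x => ((F.map z) x).toReal) + ∑ z₀, ((F.map z) z₀).toReal * ent (condLaw F z w z₀) := by
  rw [ent, Fintype.sum_prod_type, ent, ← Finset.sum_add_distrib]
  refine Finset.sum_congr rfl fun z₀ _ => ?_
  have h : ∀ w₀, ((F.map fun c => (z c, w c)) (z₀, w₀)).toReal =
      ((F.map z) z₀).toReal * condLaw F z w z₀ w₀ := fun w₀ => by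
    rw [← mul_ofReal_condLaw, ENNReal.toReal_mul, ENNReal.toReal_ofReal (condLaw_nonneg _ _ _ _ _)]
  simp only [h, Real.negMulLog_mul, Finset.sum_add_distrib, ← Finset.sum_mul, ← Finset.mul_sum]
  by_cases h0 : (F.map z) z₀ = 0
  · simp [h0]
  · rw [(condLaw_mem_stdSimplex F z w h0).2, one_mul, ent]

theorem marg_condLaw {T : Type} [Fintype W] (F : PMF C) (z : C → Z) (w : C → W) (g : W → T) (z₀ : Z) :
    marg g (condLaw F z w z₀) = condLaw F z (fun c => g (w c)) z₀ := by
  classical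
  funext b
  by_cases h0 : (F.map z) z₀ = 0
  · simp [marg, condLaw, h0]
  have h1 : (F.map fun c => (z c, g (w c))) (z₀, b) =
      ∑ w₀, if g w₀ = b then (F.map fun c => (z c, w c)) (z₀, w₀) else 0 := by
    have h2 : ∀ w₀, (if g w₀ = b then (F.map fun c => (z c, w c)) (z₀, w₀) else 0) =
        ∑' c, if g w₀ = b ∧ (z₀, w₀) = (z c, w c) then F c else 0 := fun w₀ => by
      rw [PMF.map_apply]
      by_cases h : g w₀ = b <;> simp [h]
    rw [Finset.sum_congr rfl fun w₀ _ => h2 w₀, ← tsum_fintype (L := .unconditional _),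
      ENNReal.tsum_comm, PMF.map_apply]
    refine tsum_congr fun c => ?_
    rw [tsum_eq_single (w c) fun w₀ hw => by simp [hw]]
    simp only [Prod.mk.injEq, and_true]
    exact if_congr ⟨fun h => ⟨h.2.symm, h.1⟩, fun h => ⟨h.2, h.1.symm⟩⟩ rfl rfl
  simp only [marg, condLaw]
  rw [h1, div_eq_mul_inv, Finset.sum_mul, ENNReal.toReal_sum]
  · refine Finset.sum_congr rfl fun w₀ _ => ?_
    split_ifs <;> simp [div_eq_mul_inv]
  · intro w₀ _
    split_ifs
    · exact ENNReal.mul_ne_top ((F.map _).apply_ne_top _) (ENNReal.inv_ne_top.2 h0)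
    · simp

end Shannon

/-- The equality case of Gibbs' inequality: every termwise inequality is tight, and `log x < x - 1`
unless `x = 1`. -/
theorem eq_of_cross_le {U : Type} [Fintype U] {a r : U → ℝ} (ha : ∀ u, 0 ≤ a u)
    (hr : ∀ u, 0 ≤ r u) (h : ∀ u, a u ≠ 0 → r u ≠ 0) (hs : ∑ u, r u ≤ ∑ u, a u)
    (hle : ∑ u, a u * (-Real.log (r u)) ≤ ent a) (u : U) : a u = r u := by
  have h1 : ∀ u ∈ Finset.univ, Real.negMulLog (a u) ≤ a u * (-Real.log (r u)) + r u - a u :=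
    fun u _ => negMulLog_le_cross (ha u) (hr u) (h u)
  have h2 : ∑ u, Real.negMulLog (a u) = ∑ u, (a u * (-Real.log (r u)) + r u - a u) := by
    refine le_antisymm (Finset.sum_le_sum h1) ?_
    rw [Finset.sum_sub_distrib, Finset.sum_add_distrib]
    rw [ent] at hle
    linarith
  have h3 := (Finset.sum_eq_sum_iff_of_le h1).1 h2 u (Finset.mem_univ u)
  by_cases h0 : a u = 0
  · rw [h0] at h3 ⊢
    simpa using h3
  · have ha' : 0 < a u := lt_of_le_of_ne (ha u) (Ne.symm h0)
    have hr' : 0 < r u := lt_of_le_of_ne (hr u) (Ne.symm (h u h0))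
    by_contra hne
    have h4 := Real.log_lt_sub_one_of_pos (div_pos hr' ha')
      (fun h => hne ((div_eq_one_iff_eq h0).1 h).symm)
    rw [Real.log_div hr'.ne' h0] at h4
    have h5 := mul_lt_mul_of_pos_left h4 ha'
    have h6 : a u * (r u / a u - 1) = r u - a u := by field_simp
    rw [h6] at h5
    simp only [Real.negMulLog] at h3
    linarith

/-- A pair with additive entropy is independent. -/
theorem eq_marg_mul_marg {X Y : Type} [Fintype X] [Fintype Y] {a : X × Y → ℝ}
    (ha : a ∈ stdSimplex ℝ (X × Y))
    (hle : ent (marg Prod.fst a) + ent (marg Prod.snd a) ≤ ent a) (x : X) (y : Y) :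
    a (x, y) = marg Prod.fst a x * marg Prod.snd a y := by
  have hm := marg_mem_stdSimplex Prod.fst ha
  have hm' := marg_mem_stdSimplex Prod.snd ha
  refine eq_of_cross_le (r := fun u => marg Prod.fst a u.1 * marg Prod.snd a u.2) ha.1
    (fun u => mul_nonneg (hm.1 _) (hm'.1 _))
    (fun u hu => mul_ne_zero (marg_ne_zero Prod.fst ha.1 hu) (marg_ne_zero Prod.snd ha.1 hu))
    ?_ ?_ (x, y)
  · rw [Fintype.sum_prod_type, ← Finset.sum_mul_sum, hm.2, hm'.2, ha.2, one_mul]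
  · refine le_of_eq_of_le ?_ hle
    have h2 : ent (marg Prod.fst a) = ∑ u, a u * (-Real.log (marg Prod.fst a u.1)) := by
      rw [← sum_marg_mul Prod.fst a fun t => -Real.log (marg Prod.fst a t)]
      simp [ent, Real.negMulLog]
    have h3 : ent (marg Prod.snd a) = ∑ u, a u * (-Real.log (marg Prod.snd a u.2)) := by
      rw [← sum_marg_mul Prod.snd a fun t => -Real.log (marg Prod.snd a t)]
      simp [ent, Real.negMulLog]
    rw [h2, h3, ← Finset.sum_add_distrib]
    refine Finset.sum_congr rfl fun u _ => ?_
    by_cases h0 : a u = 0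
    · simp [h0]
    · rw [Real.log_mul (marg_ne_zero Prod.fst ha.1 h0) (marg_ne_zero Prod.snd ha.1 h0)]; ring

/-! ### Conditional entropy -/

section CondEnt

variable {C X Y Q W : Type} [Fintype X] [Fintype Y]

theorem mul_ent_condLaw_pair_le (F : PMF C) (z : C → Q) (x : C → X) (y : C → Y) (q : Q) :
    ((F.map z) q).toReal * ent (condLaw F z (fun c => (x c, y c)) q) ≤
      ((F.map z) q).toReal * (ent (condLaw F z x q) + ent (condLaw F z y q)) := by
  by_cases hq : (F.map z) q = 0
  · rw [hq]; simp
  · refine mul_le_mul_of_nonneg_left ?_ ENNReal.toReal_nonneg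
    have := ent_le_marg_add_marg Prod.fst Prod.snd (fun _ _ h => h)
      (condLaw_mem_stdSimplex F z (fun c => (x c, y c)) hq)
    rwa [marg_condLaw, marg_condLaw] at this

variable [Fintype Q] [Fintype W]

/-- The conditional entropy, in nats, of `w` given `z`. -/
noncomputable def condEnt (F : PMF C) (z : C → Q) (w : C → W) : ℝ :=
  ∑ z₀, ((F.map z) z₀).toReal * ent (condLaw F z w z₀)

theorem shannonEntropy_map_pair (F : PMF C) (z : C → Q) (w : C → W) :
    shannonEntropy (F.map fun c => (w c, z c)) =
      shannonEntropy (F.map z) + condEnt F z w / Real.log 2 := by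
  rw [← shannonEntropy_map_equiv _ (Equiv.prodComm W Q), PMF.map_comp]
  refine (shannonEntropy_eq_ent (F.map fun c => (z c, w c))).trans ?_
  rw [ent_map_pair, shannonEntropy_eq_ent, add_div]
  rfl

theorem condEnt_add_condEnt (F : PMF C) (z : C → Q) (x : C → X) (y : C → Y) :
    condEnt F z x + condEnt F z y =
      ∑ q, ((F.map z) q).toReal * (ent (condLaw F z x q) + ent (condLaw F z y q)) := by
  simp only [condEnt, mul_add, Finset.sum_add_distrib]

theorem condEnt_pair_le (F : PMF C) (z : C → Q) (x : C → X) (y : C → Y) :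
    condEnt F z (fun c => (x c, y c)) ≤ condEnt F z x + condEnt F z y := by
  rw [condEnt_add_condEnt]
  exact Finset.sum_le_sum fun q _ => mul_ent_condLaw_pair_le F z x y q

/-- If `x` and `y` are independent given `z`, a bound for independent pairs of laws bounds the sum
of their conditional entropies. -/
theorem condEnt_add_condEnt_le (F : PMF C) (z : C → Q) (x : C → X) (y : C → Y) {E : ℝ}
    (hge : condEnt F z x + condEnt F z y ≤ condEnt F z fun c => (x c, y c))
    (hloc : ∀ a ∈ stdSimplex ℝ X, ∀ b ∈ stdSimplex ℝ Y,
      (∀ x₀ y₀, (F.map fun c => (x c, y c)) (x₀, y₀) = 0 → a x₀ * b y₀ = 0) → ent a + ent b ≤ E) :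
    condEnt F z x + condEnt F z y ≤ E := by
  -- Subadditivity holds for each value of `z`; equality in the sum forces equality, and hence
  -- independence, at every value of positive mass.
  have heq := (Finset.sum_eq_sum_iff_of_le fun q _ => mul_ent_condLaw_pair_le F z x y q).1
    (le_antisymm (Finset.sum_le_sum fun q _ => mul_ent_condLaw_pair_le F z x y q)
      (by rw [← condEnt_add_condEnt]; exact hge))
  rw [condEnt_add_condEnt, ← one_mul E, ← sum_toReal_pmf (F.map z), Finset.sum_mul]
  refine Finset.sum_le_sum fun q _ => ?_
  by_cases hq : (F.map z) q = 0
  · rw [hq]; simp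
  have hq' : ((F.map z) q).toReal ≠ 0 :=
    ENNReal.toReal_ne_zero.2 ⟨hq, (F.map z).apply_ne_top q⟩
  refine mul_le_mul_of_nonneg_left ?_ ENNReal.toReal_nonneg
  refine hloc _ (condLaw_mem_stdSimplex F z x hq) _ (condLaw_mem_stdSimplex F z y hq)
    fun x₀ y₀ h0 => ?_
  have hs := condLaw_mem_stdSimplex F z (fun c => (x c, y c)) hq
  have h1 := mul_left_cancel₀ hq' (heq q (Finset.mem_univ q))
  have h2 := eq_marg_mul_marg hs (by rw [marg_condLaw, marg_condLaw]; exact h1.ge) x₀ y₀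
  rw [marg_condLaw, marg_condLaw] at h2
  rw [← h2]
  -- Conditioning cannot enlarge the support, so zeros of the joint law are inherited.
  have h3 : (F.map fun c => (z c, (x c, y c))) (q, (x₀, y₀)) = 0 := by
    rw [PMF.apply_eq_zero_iff, PMF.mem_support_map_iff] at h0 ⊢
    rintro ⟨c, hc, h4⟩
    exact h0 ⟨c, hc, (Prod.mk.inj h4).2⟩
  rw [condLaw, h3, ENNReal.zero_div, ENNReal.toReal_zero]

end CondEnt

/-! ### Lower bounds on tensions -/

theorem jointWith_map_fst {X Y Q : Type} (p : PMF (X × Y)) (κ : X × Y → PMF Q) :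
    (jointWith p κ).map Prod.fst = p := by
  rw [jointWith, PMF.map_bind]
  simp only [PMF.map_comp]
  conv_rhs => rw [← PMF.bind_pure p]
  congr 1
  funext xy
  exact PMF.map_const (κ xy) xy

section Tension

variable {X Y Q : Type} [Fintype X] [Fintype Y] [Fintype Q]

/-- A lower bound on the sum of the first two coordinates of a tension whose third coordinate
vanishes. -/
theorem le_tension_add (p : PMF (X × Y)) (κ : X × Y → PMF Q) {E : ℝ}
    (h0 : (tension p κ).2.2 ≤ 0)
    (hloc : ∀ a ∈ stdSimplex ℝ X, ∀ b ∈ stdSimplex ℝ Y,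
      (∀ x y, p (x, y) = 0 → a x * b y = 0) → ent a + ent b ≤ E * Real.log 2) :
    2 * shannonEntropy p - shannonEntropy (p.map Prod.fst) - shannonEntropy (p.map Prod.snd) - E ≤
      (tension p κ).1 + (tension p κ).2.1 := by
  have hl : 0 < Real.log 2 := Real.log_pos (by norm_num)
  simp only [tension, condMutualInfo] at h0 ⊢
  have e0 := jointWith_map_fst p κ
  generalize jointWith p κ = J at *
  have e1 : J.map (fun ω => ω.1.1) = p.map Prod.fst := by
    rw [← e0, PMF.map_comp]; rfl
  have e2 : J.map (fun ω => ω.1.2) = p.map Prod.snd := by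
    rw [← e0, PMF.map_comp]; rfl
  have e3 : J.map (fun ω => (ω.1.1, ω.1.2)) = p := e0
  have e3' : shannonEntropy (J.map fun ω => (ω.1.2, ω.1.1)) = shannonEntropy p := by
    rw [← shannonEntropy_map_equiv p (Equiv.prodComm X Y), ← e0, PMF.map_comp]
    rfl
  have e4 : shannonEntropy (J.map fun ω => (ω.2, ω.1.1)) =
      shannonEntropy (J.map fun ω => (ω.1.1, ω.2)) := by
    rw [← shannonEntropy_map_equiv (J.map fun ω => (ω.1.1, ω.2)) (Equiv.prodComm _ _),
      PMF.map_comp]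
    rfl
  have e5 : shannonEntropy (J.map fun ω => (ω.2, ω.1.2)) =
      shannonEntropy (J.map fun ω => (ω.1.2, ω.2)) := by
    rw [← shannonEntropy_map_equiv (J.map fun ω => (ω.1.2, ω.2)) (Equiv.prodComm _ _),
      PMF.map_comp]
    rfl
  have e8 : shannonEntropy (J.map fun ω => (ω.1.1, ω.1.2, ω.2)) =
      shannonEntropy (J.map fun ω => ((ω.1.1, ω.1.2), ω.2)) := by
    rw [← shannonEntropy_map_equiv (J.map fun ω => ((ω.1.1, ω.1.2), ω.2))
      (Equiv.prodAssoc _ _ _), PMF.map_comp]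
    rfl
  have e6 : shannonEntropy (J.map fun ω => (ω.1.2, ω.2, ω.1.1)) =
      shannonEntropy (J.map fun ω => ((ω.1.1, ω.1.2), ω.2)) := by
    rw [← e8, ← shannonEntropy_map_equiv (J.map fun ω => (ω.1.1, ω.1.2, ω.2))
      ((Equiv.prodComm _ _).trans (Equiv.prodAssoc _ _ _)), PMF.map_comp]
    rfl
  have e7 : shannonEntropy (J.map fun ω => (ω.1.1, ω.2, ω.1.2)) =
      shannonEntropy (J.map fun ω => ((ω.1.1, ω.1.2), ω.2)) := by
    rw [← e8, ← shannonEntropy_map_equiv (J.map fun ω => (ω.1.1, ω.1.2, ω.2))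
      ((Equiv.refl _).prodCongr (Equiv.prodComm _ _)), PMF.map_comp]
    rfl
  have c1 := shannonEntropy_map_pair J (fun ω => ω.2) (fun ω => ω.1.1)
  have c2 := shannonEntropy_map_pair J (fun ω => ω.2) (fun ω => ω.1.2)
  have c3 := shannonEntropy_map_pair J (fun ω => ω.2) (fun ω => (ω.1.1, ω.1.2))
  have h1 := condEnt_pair_le J (fun ω => ω.2) (fun ω => ω.1.1) (fun ω => ω.1.2)
  have h2 := condEnt_add_condEnt_le J (fun ω => ω.2) (fun ω => ω.1.1) (fun ω => ω.1.2)
    (E := E * Real.log 2) (by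
      rw [e8, c1, c2, c3] at h0
      have := mul_nonpos_of_nonpos_of_nonneg h0 hl.le
      field_simp at this
      linarith) (by rw [e3]; exact hloc)
  -- The sum becomes `2H(X,Y) - H(X) - H(Y) + H(X|Q) + H(Y|Q) - 2H(X,Y|Q)`. Subadditivity `h1`
  -- leaves `-(H(X|Q) + H(Y|Q))`, which `h2` bounds by `-E`.
  rw [e1, e2, e3, e3', e4, e5, e6, e7, c1, c2, c3]
  have h3 := div_le_div_of_nonneg_right h1 hl.le
  have h4 := div_le_div_of_nonneg_right h2 hl.le
  rw [mul_div_cancel_right₀ _ hl.ne', add_div] at h4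
  rw [add_div] at h3
  linarith

end Tension

/-! ### Pairs of opposite bit-OTs -/

section Pair

/-- Each of the two OT directions contributes at most one bit. -/
theorem ent_add_ent_le_of_consistent {a b : OTPairShare 1 → ℝ} (ha : a ∈ stdSimplex ℝ _)
    (hb : b ∈ stdSimplex ℝ _) (h : ∀ x y, otPair 1 (x, y) = 0 → a x * b y = 0) :
    ent a + ent b ≤ 2 * Real.log 2 := by
  have hinj : Function.Injective fun u : OTPairShare 1 => (u.sent, u.got) := fun u v h => by
    simp only [Prod.mk.injEq] at h
    exact Prod.ext h.2.1 (Prod.ext h.1 h.2.2)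
  have h0 : ∀ x y : OTPairShare 1, ¬ x.Consistent y → a x * b y = 0 := fun x y hxy =>
    h x y (by rw [otPair_apply, if_neg hxy])
  have h1 := ent_le_marg_add_marg _ _ hinj ha
  have h2 := ent_le_marg_add_marg _ _ hinj hb
  have h3 := ent_add_ent_le_of_otError_eq_zero card_bitString_one
    (marg_mem_stdSimplex OTPairShare.sent ha) (marg_mem_stdSimplex OTPairShare.got hb) (by
      rw [otError_marg]
      refine Finset.sum_eq_zero fun x _ => Finset.sum_eq_zero fun y _ => ?_
      split_ifs with hxy
      · exact h0 x y fun hc => hxy hc.1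
      · rfl)
  have h4 := ent_add_ent_le_of_otError_eq_zero card_bitString_one
    (marg_mem_stdSimplex OTPairShare.sent hb) (marg_mem_stdSimplex OTPairShare.got ha) (by
      rw [otError_marg]
      refine Finset.sum_eq_zero fun y _ => Finset.sum_eq_zero fun x _ => ?_
      split_ifs with hxy
      · rw [mul_comm]
        exact h0 x y fun hc => hxy hc.2
      · rfl)
  linarith

/-- The pair of shares of a sample. -/
def otShares (ω : OTSpace 1) : OTPairShare 1 × OTPairShare 1 :=
  ((ω.1.1, ω.2.1, ω.2.2 ω.1.1), (ω.1.2, ω.2.2, ω.2.1 ω.1.2))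

/-- The choices of both parties and the bits that they receive, as a number. -/
noncomputable def revealIndex (xy : OTPairShare 1 × OTPairShare 1) : Fin 16 :=
  Fintype.equivFinOfCardEq (α := (Fin 2 × BitString 1) × (Fin 2 × BitString 1)) (by simp)
    (xy.1.got, xy.2.got)

theorem revealIndex_eq_iff {xy xy' : OTPairShare 1 × OTPairShare 1} :
    revealIndex xy = revealIndex xy' ↔ xy.1.got = xy'.1.got ∧ xy.2.got = xy'.2.got := by
  rw [revealIndex, revealIndex, EmbeddingLike.apply_eq_iff_eq, Prod.mk.injEq]

theorem jointWith_pure {Ω X Y Q : Type} (p : PMF Ω) (f : Ω → X × Y) (g : X × Y → Q) :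
    jointWith (p.map f) (fun xy => PMF.pure (g xy)) = p.map fun ω => (f ω, g (f ω)) := by
  rw [jointWith, PMF.bind_map, ← PMF.bind_pure_comp]
  congr 1
  funext ω
  exact PMF.pure_map _ _

/-- In coordinates `A × B` on the sample space, a function with the level sets of the first
coordinate has fibres of size `|B|`. -/
theorem shannonEntropy_map_of_bijective {Ω α A B : Type} [Fintype Ω] [Nonempty Ω] [Fintype α]
    [Fintype A] [Fintype B] (F : Ω → α) {f : Ω → A} {g : Ω → B}
    (hfg : Function.Bijective fun ω => (f ω, g ω)) (hF : ∀ ω ω', F ω = F ω' ↔ f ω = f ω') :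
    shannonEntropy ((PMF.uniformOfFintype Ω).map F) = Real.logb 2 (Fintype.card A) := by
  classical
  have hk : ∀ ω, (Finset.univ.filter fun ω' => F ω' = F ω).card = Fintype.card B := fun ω => by
    refine Finset.card_bij (t := Finset.univ) (fun ω' _ => g ω') (fun _ _ => Finset.mem_univ _)
      (fun x hx y hy h => ?_) fun b _ => ?_
    · simp only [Finset.mem_filter, Finset.mem_univ, true_and, hF] at hx hy
      exact hfg.1 (Prod.ext (hx.trans hy.symm) h)
    · obtain ⟨x, hx⟩ := hfg.2 (f ω, b)
      simp only [Prod.mk.injEq] at hx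
      exact ⟨x, by simp [hF, hx.1], hx.2⟩
  have hB : (Fintype.card B : ℝ) ≠ 0 := by
    have : Nonempty B := ⟨g (Classical.arbitrary Ω)⟩
    exact_mod_cast Fintype.card_ne_zero
  rw [shannonEntropy_map_uniform F hk, Fintype.card_of_bijective hfg, Fintype.card_prod,
    Nat.cast_mul, mul_div_assoc, div_self hB, mul_one]

theorem shannonEntropy_otShares {α A : Type} (B : Type) [Fintype α] [Fintype A] [Fintype B]
    (F : OTSpace 1 → α) (f : OTSpace 1 → A) (g : OTSpace 1 → B) {m : ℕ}
    (hA : Fintype.card A = 2 ^ m) (hB : 2 ^ m * Fintype.card B = 64)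
    (hfg : ∀ ω ω', f ω = f ω' → g ω = g ω' → ω = ω') (hF : ∀ ω ω', F ω = F ω' ↔ f ω = f ω') :
    shannonEntropy ((PMF.uniformOfFintype (OTSpace 1)).map F) = m := by
  have h : Function.Bijective fun ω => (f ω, g ω) := by
    rw [Fintype.bijective_iff_injective_and_card]
    refine ⟨fun ω ω' h => hfg ω ω' (congrArg Prod.fst h) (congrArg Prod.snd h), ?_⟩
    rw [Fintype.card_prod A B, hA, hB]
    simp
  rw [shannonEntropy_map_of_bijective F h hF, hA, Nat.cast_pow, Nat.cast_ofNat, Real.logb_pow]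
  simp

theorem eq_of_apply_eq_of_apply_rev_eq {T : Type} {s s' : Fin 2 → T} (c : Fin 2)
    (h : s c = s' c) (h' : s c.rev = s' c.rev) : s = s' := by
  funext i
  have hi : ∀ c i : Fin 2, i = c ∨ i = c.rev := by decide
  rcases hi c i with rfl | rfl
  exacts [h, h']

/-! ### Entropies of functions of a sample of the opposite pair -/

section Entropies

variable {α : Type} [Fintype α] (F : OTSpace 1 → α)

/-- Phrasing the hypothesis through level sets covers every reordering and every redundant component
of a tuple. -/
theorem shannonEntropy_of_iff_otShares (hF : ∀ ω ω', F ω = F ω' ↔ otShares ω = otShares ω') :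
    shannonEntropy ((PMF.uniformOfFintype (OTSpace 1)).map F) = 6 :=
  shannonEntropy_otShares (m := 6) Unit F id (fun _ => ()) (by simp) (by simp)
    (fun _ _ h _ => h) fun ω ω' => by
      rw [hF]
      exact ⟨fun h => Prod.ext (Prod.ext (congrArg (·.1.1) h) (congrArg (·.2.1) h))
        (Prod.ext (congrArg (·.1.2.1) h) (congrArg (·.2.2.1) h)), congrArg _⟩

theorem shannonEntropy_of_iff_fst (hF : ∀ ω ω', F ω = F ω' ↔ (otShares ω).1 = (otShares ω').1) :
    shannonEntropy ((PMF.uniformOfFintype (OTSpace 1)).map F) = 4 :=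
  shannonEntropy_otShares (m := 4) (Fin 2 × BitString 1) F (fun ω => (otShares ω).1)
    (fun ω => (ω.1.2, ω.2.2 ω.1.1.rev)) (by simp) (by simp)
    (by
      rintro ⟨⟨c, d⟩, s, t⟩ ⟨⟨c', d'⟩, s', t'⟩ h h'
      simp only [otShares, Prod.mk.injEq] at h h'
      obtain ⟨rfl, rfl, h⟩ := h
      obtain ⟨rfl, h'⟩ := h'
      rw [eq_of_apply_eq_of_apply_rev_eq c h h'])
    hF

theorem shannonEntropy_of_iff_snd (hF : ∀ ω ω', F ω = F ω' ↔ (otShares ω).2 = (otShares ω').2) :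
    shannonEntropy ((PMF.uniformOfFintype (OTSpace 1)).map F) = 4 :=
  shannonEntropy_otShares (m := 4) (Fin 2 × BitString 1) F (fun ω => (otShares ω).2)
    (fun ω => (ω.1.1, ω.2.1 ω.1.2.rev)) (by simp) (by simp)
    (by
      rintro ⟨⟨c, d⟩, s, t⟩ ⟨⟨c', d'⟩, s', t'⟩ h h'
      simp only [otShares, Prod.mk.injEq] at h h'
      obtain ⟨rfl, rfl, h⟩ := h
      obtain ⟨rfl, h'⟩ := h'
      rw [eq_of_apply_eq_of_apply_rev_eq d h h'])
    hF

/-- Beyond the own share, only the other party's choice is new; the bit received there is then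
determined. -/
theorem shannonEntropy_of_iff_fst_reveal (hF : ∀ ω ω', F ω = F ω' ↔
      (otShares ω).1 = (otShares ω').1 ∧ revealIndex (otShares ω) = revealIndex (otShares ω')) :
    shannonEntropy ((PMF.uniformOfFintype (OTSpace 1)).map F) = 5 :=
  shannonEntropy_otShares (m := 5) (BitString 1) F (fun ω => ((otShares ω).1, ω.1.2))
    (fun ω => ω.2.2 ω.1.1.rev) (by simp) (by simp)
    (by
      rintro ⟨⟨c, d⟩, s, t⟩ ⟨⟨c', d'⟩, s', t'⟩ h h'
      simp only [otShares, Prod.mk.injEq] at h h'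
      obtain ⟨⟨rfl, rfl, h⟩, rfl⟩ := h
      rw [eq_of_apply_eq_of_apply_rev_eq c h h'])
    (by
      rintro ⟨⟨c, d⟩, s, t⟩ ⟨⟨c', d'⟩, s', t'⟩
      rw [hF, revealIndex_eq_iff]
      simp only [otShares, Prod.mk.injEq]
      constructor
      · rintro ⟨h, -, h', -⟩
        exact ⟨h, h'⟩
      · rintro ⟨⟨rfl, rfl, h⟩, rfl⟩
        exact ⟨⟨rfl, rfl, h⟩, ⟨rfl, h⟩, rfl, rfl⟩)

theorem shannonEntropy_of_iff_snd_reveal (hF : ∀ ω ω', F ω = F ω' ↔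
      (otShares ω).2 = (otShares ω').2 ∧ revealIndex (otShares ω) = revealIndex (otShares ω')) :
    shannonEntropy ((PMF.uniformOfFintype (OTSpace 1)).map F) = 5 :=
  shannonEntropy_otShares (m := 5) (BitString 1) F (fun ω => ((otShares ω).2, ω.1.1))
    (fun ω => ω.2.1 ω.1.2.rev) (by simp) (by simp)
    (by
      rintro ⟨⟨c, d⟩, s, t⟩ ⟨⟨c', d'⟩, s', t'⟩ h h'
      simp only [otShares, Prod.mk.injEq] at h h'
      obtain ⟨⟨rfl, rfl, h⟩, rfl⟩ := h
      rw [eq_of_apply_eq_of_apply_rev_eq d h h'])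
    (by
      rintro ⟨⟨c, d⟩, s, t⟩ ⟨⟨c', d'⟩, s', t'⟩
      rw [hF, revealIndex_eq_iff]
      simp only [otShares, Prod.mk.injEq]
      constructor
      · rintro ⟨h, ⟨h', -⟩, -⟩
        exact ⟨h, h'⟩
      · rintro ⟨⟨rfl, rfl, h⟩, rfl⟩
        exact ⟨⟨rfl, rfl, h⟩, ⟨rfl, rfl⟩, rfl, h⟩)

theorem shannonEntropy_revealIndex :
    shannonEntropy ((PMF.uniformOfFintype (OTSpace 1)).map fun ω => revealIndex (otShares ω)) = 4 :=
  shannonEntropy_otShares (m := 4) (BitString 1 × BitString 1) _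
    (fun ω => ((otShares ω).1.got, (otShares ω).2.got))
    (fun ω => (ω.2.1 ω.1.2.rev, ω.2.2 ω.1.1.rev)) (by simp) (by simp)
    (by
      rintro ⟨⟨c, d⟩, s, t⟩ ⟨⟨c', d'⟩, s', t'⟩ h h'
      simp only [otShares, Prod.mk.injEq] at h h'
      obtain ⟨⟨rfl, ht⟩, rfl, hs⟩ := h
      rw [eq_of_apply_eq_of_apply_rev_eq c ht h'.2, eq_of_apply_eq_of_apply_rev_eq d hs h'.1])
    (fun ω ω' => revealIndex_eq_iff.trans Prod.mk_inj.symm)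

end Entropies

/-- Given the revealed data, each party keeps one independent unread bit. In numbers, `6 + 5 - 6 - 4
= 1` for the first two coordinates and `5 + 5 - 6 - 4 = 0` for the last. -/
theorem tension_otPair :
    tension (otPair 1) (fun xy => PMF.pure (revealIndex xy)) = (1, 1, 0) := by
  have e : otPair 1 = (PMF.uniformOfFintype (OTSpace 1)).map otShares := rfl
  simp only [tension, condMutualInfo]
  rw [e, jointWith_pure]
  simp only [PMF.map_comp, Function.comp_def]
  have h : ∀ ω ω', otShares ω = otShares ω' →
      revealIndex (otShares ω) = revealIndex (otShares ω') := fun ω ω' h => by rw [h]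
  rw [shannonEntropy_of_iff_otShares fun ω => ((otShares ω).2, (otShares ω).1),
    shannonEntropy_of_iff_fst_reveal fun ω => (revealIndex (otShares ω), (otShares ω).1),
    shannonEntropy_of_iff_otShares fun ω =>
      ((otShares ω).2, revealIndex (otShares ω), (otShares ω).1),
    shannonEntropy_of_iff_fst fun ω => (otShares ω).1,
    shannonEntropy_of_iff_otShares fun ω => ((otShares ω).1, (otShares ω).2),
    shannonEntropy_of_iff_snd_reveal fun ω => (revealIndex (otShares ω), (otShares ω).2),
    shannonEntropy_of_iff_otShares fun ω =>
      ((otShares ω).1, revealIndex (otShares ω), (otShares ω).2),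
    shannonEntropy_of_iff_snd fun ω => (otShares ω).2,
    shannonEntropy_of_iff_fst_reveal fun ω => ((otShares ω).1, revealIndex (otShares ω)),
    shannonEntropy_of_iff_snd_reveal fun ω => ((otShares ω).2, revealIndex (otShares ω)),
    shannonEntropy_of_iff_otShares fun ω =>
      ((otShares ω).1, (otShares ω).2, revealIndex (otShares ω)),
    shannonEntropy_revealIndex]
  · norm_num
  all_goals
    intro ω ω'
    have h' := h ω ω'
    have e' : otShares ω = otShares ω' ↔
      (otShares ω).1 = (otShares ω').1 ∧ (otShares ω).2 = (otShares ω').2 := Prod.ext_iff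
    simp only [e'] at h'
    simp only [Prod.mk.injEq, e'] <;> tauto

theorem shannonEntropy_otPair : shannonEntropy (otPair 1) = 6 ∧
    shannonEntropy ((otPair 1).map Prod.fst) = 4 ∧
    shannonEntropy ((otPair 1).map Prod.snd) = 4 := by
  have e : otPair 1 = (PMF.uniformOfFintype (OTSpace 1)).map otShares := rfl
  rw [e, PMF.map_comp, PMF.map_comp]
  exact ⟨shannonEntropy_of_iff_otShares _ fun _ _ => Iff.rfl,
    shannonEntropy_of_iff_fst _ fun _ _ => Iff.rfl, shannonEntropy_of_iff_snd _ fun _ _ => Iff.rfl⟩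

theorem mem_tensionRegion_otPair : ((1 : ℝ), (1 : ℝ), (0 : ℝ)) ∈ tensionRegion (otPair 1) :=
  ⟨⟨zero_le_one, zero_le_one, le_rfl⟩, _, ⟨16, _, tension_otPair.symm⟩, le_rfl⟩

/-- The constant is `2·6 - 4 - 4 - 2`. -/
theorem two_le_of_mem_tensionRegion {R₁ R₂ : ℝ}
    (h : (R₁, R₂, (0 : ℝ)) ∈ tensionRegion (otPair 1)) : 2 ≤ R₁ + R₂ := by
  obtain ⟨-, _, ⟨k, κ, rfl⟩, h1, h2, h3⟩ := h
  have h4 := le_tension_add (E := 2) (otPair 1) κ h3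
    fun a ha b hb hab => ent_add_ent_le_of_consistent ha hb hab
  obtain ⟨e1, e2, e3⟩ := shannonEntropy_otPair
  rw [e1, e2, e3] at h4
  simp only at h1 h2
  linarith

end Pair

/-! ### A single bit-OT -/

section Single

/-- A single bit-OT, as a function of its sample. -/
def bitOTShares (ω : (Fin 2 → Bool) × Fin 2) : (Fin 2 → Bool) × (Fin 2 × Bool) :=
  (ω.1, (ω.2, ω.1 ω.2))

theorem bitOT_apply_eq_zero {a : Fin 2 → Bool} {b : Fin 2 × Bool} (h : a b.1 ≠ b.2) :
    bitOT (a, b) = 0 := by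
  rw [PMF.apply_eq_zero_iff, bitOT, PMF.mem_support_map_iff]
  rintro ⟨ω, -, h1⟩
  simp only [Prod.mk.injEq] at h1
  obtain ⟨rfl, rfl⟩ := h1
  exact h rfl

/-- The receiver's share, as a number. -/
def receiverIndex (ab : (Fin 2 → Bool) × (Fin 2 × Bool)) : Fin 4 :=
  Fin.ofNat 4 (2 * ab.2.1.val + ab.2.2.toNat)

theorem shannonEntropy_bitOTShares {α : Type} [Fintype α] [DecidableEq α]
    (F : (Fin 2 → Bool) × Fin 2 → α) {k m : ℕ} (hkm : k * 2 ^ m = 8)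
    (h : ∀ ω, (Finset.univ.filter fun ω' => F ω' = F ω).card = k) :
    shannonEntropy ((PMF.uniformOfFintype ((Fin 2 → Bool) × Fin 2)).map F) = m := by
  have hk : (k : ℝ) ≠ 0 := by
    rintro h0
    have : k = 0 := by exact_mod_cast h0
    simp [this] at hkm
  have h2 : ((8 : ℕ) : ℝ) / k = 2 ^ m := by
    rw [← hkm]; push_cast; field_simp
  have h3 : Fintype.card ((Fin 2 → Bool) × Fin 2) = 8 := by simp
  rw [shannonEntropy_map_uniform F h, h3, h2, Real.logb_pow]
  simp

/-- With `Q` a relabelling of the receiver's share, the last two coordinates vanish and the first is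
`H(B|A) = 1`, the choice bit. -/
theorem tension_bitOT : tension bitOT (fun ab => PMF.pure (receiverIndex ab)) = (1, 0, 0) := by
  have e : bitOT = (PMF.uniformOfFintype ((Fin 2 → Bool) × Fin 2)).map bitOTShares := rfl
  simp only [tension, condMutualInfo]
  rw [e, jointWith_pure]
  simp only [PMF.map_comp, Function.comp_def]
  rw [shannonEntropy_bitOTShares (m := 3) (k := 1)
      (fun ω => ((bitOTShares ω).2, (bitOTShares ω).1)) rfl (by decide),
    shannonEntropy_bitOTShares (m := 3) (k := 1)
      (fun ω => (receiverIndex (bitOTShares ω), (bitOTShares ω).1)) rfl (by decide),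
    shannonEntropy_bitOTShares (m := 3) (k := 1)
      (fun ω => ((bitOTShares ω).2, receiverIndex (bitOTShares ω), (bitOTShares ω).1)) rfl (by decide),
    shannonEntropy_bitOTShares (m := 2) (k := 2)
      (fun ω => (bitOTShares ω).1) rfl (by decide),
    shannonEntropy_bitOTShares (m := 3) (k := 1)
      (fun ω => ((bitOTShares ω).1, (bitOTShares ω).2)) rfl (by decide),
    shannonEntropy_bitOTShares (m := 2) (k := 2)
      (fun ω => (receiverIndex (bitOTShares ω), (bitOTShares ω).2)) rfl (by decide),
    shannonEntropy_bitOTShares (m := 3) (k := 1)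
      (fun ω => ((bitOTShares ω).1, receiverIndex (bitOTShares ω), (bitOTShares ω).2)) rfl (by decide),
    shannonEntropy_bitOTShares (m := 2) (k := 2)
      (fun ω => (bitOTShares ω).2) rfl (by decide),
    shannonEntropy_bitOTShares (m := 3) (k := 1)
      (fun ω => ((bitOTShares ω).1, receiverIndex (bitOTShares ω))) rfl (by decide),
    shannonEntropy_bitOTShares (m := 2) (k := 2)
      (fun ω => ((bitOTShares ω).2, receiverIndex (bitOTShares ω))) rfl (by decide),
    shannonEntropy_bitOTShares (m := 3) (k := 1)
      (fun ω => ((bitOTShares ω).1, (bitOTShares ω).2, receiverIndex (bitOTShares ω))) rfl (by decide),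
    shannonEntropy_bitOTShares (m := 2) (k := 2)
      (fun ω => receiverIndex (bitOTShares ω)) rfl (by decide)]
  norm_num

theorem shannonEntropy_bitOT : shannonEntropy bitOT = 3 ∧
    shannonEntropy (bitOT.map Prod.fst) = 2 ∧ shannonEntropy (bitOT.map Prod.snd) = 2 := by
  have e : bitOT = (PMF.uniformOfFintype ((Fin 2 → Bool) × Fin 2)).map bitOTShares := rfl
  rw [e, PMF.map_comp, PMF.map_comp]
  refine ⟨?_, ?_, ?_⟩
  · exact_mod_cast shannonEntropy_bitOTShares (m := 3) (k := 1) bitOTShares rfl (by decide)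
  · exact_mod_cast shannonEntropy_bitOTShares (m := 2) (k := 2) (fun ω => (bitOTShares ω).1) rfl
      (by decide)
  · exact_mod_cast shannonEntropy_bitOTShares (m := 2) (k := 2) (fun ω => (bitOTShares ω).2) rfl
      (by decide)

theorem mem_tensionRegion_bitOT : ((1 : ℝ), (0 : ℝ), (0 : ℝ)) ∈ tensionRegion bitOT :=
  ⟨⟨zero_le_one, le_rfl, le_rfl⟩, _, ⟨4, _, tension_bitOT.symm⟩, le_rfl⟩

/-- The constant is `2·3 - 2 - 2 - 1`. -/
theorem one_le_of_mem_tensionRegion {R₁ R₂ : ℝ} (h : (R₁, R₂, (0 : ℝ)) ∈ tensionRegion bitOT) :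
    1 ≤ R₁ + R₂ := by
  obtain ⟨-, _, ⟨k, κ, rfl⟩, h1, h2, h3⟩ := h
  have h4 := le_tension_add (E := 1) bitOT κ h3 fun a ha b hb hab => by
    rw [one_mul]
    refine ent_add_ent_le_of_otError_eq_zero Fintype.card_bool ha hb ?_
    refine Finset.sum_eq_zero fun x _ => Finset.sum_eq_zero fun y _ => ?_
    split_ifs with hxy
    · exact hab x y (bitOT_apply_eq_zero hxy)
    · rfl
  obtain ⟨e1, e2, e3⟩ := shannonEntropy_bitOT
  rw [e1, e2, e3] at h4
  simp only at h1 h2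
  linarith

end Single

/-! ### Boundary points -/

theorem mem_frontier_of_seq {E : Type} [TopologicalSpace E] {s : Set E} {x : E} (hx : x ∈ s)
    (f : ℕ → E) (hf : Filter.Tendsto f Filter.atTop (nhds x)) (hs : ∀ n, f n ∉ s) :
    x ∈ frontier s := by
  refine ⟨subset_closure hx, fun hi => ?_⟩
  obtain ⟨n, hn⟩ := (hf.eventually (mem_interior_iff_mem_nhds.1 hi)).exists
  exact hs n hn

theorem mainTheorem7 :
    (∀ L : ℕ, 1 ≤ L → IsStatSamplingRate (otPair L) (otPair 1) 1) ∧
    (((1 : ℝ), (1 : ℝ), (0 : ℝ)) ∈ tensionRegion (otPair 1) ∧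
      ((1 : ℝ), (1 : ℝ), (0 : ℝ)) ∈ frontier (tensionRegion (otPair 1)) ∧
      ((1 : ℝ), (1 : ℝ)) ∈
        frontier {R : ℝ × ℝ | (R.1, R.2, (0 : ℝ)) ∈ tensionRegion (otPair 1)}) ∧
    IsLeast {s : ℝ | ∃ R₁ R₂ : ℝ, (R₁, R₂, (0 : ℝ)) ∈ tensionRegion (otPair 1) ∧ s = R₁ + R₂} 2 ∧
    IsLeast {s : ℝ | ∃ R₁ R₂ : ℝ, (R₁, R₂, (0 : ℝ)) ∈ tensionRegion bitOT ∧ s = R₁ + R₂} 1 := by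
  have hlim : Filter.Tendsto (fun n : ℕ => (1 : ℝ) - 1 / ((n : ℝ) + 1)) Filter.atTop (nhds 1) := by
    simpa using tendsto_const_nhds.sub (tendsto_one_div_add_atTop_nhds_zero_nat (𝕜 := ℝ))
  have hpos : ∀ n : ℕ, 0 < 1 / ((n : ℝ) + 1) := fun n => Nat.one_div_pos_of_nat
  refine ⟨fun L hL => isStatSamplingRate_otPair hL, ⟨mem_tensionRegion_otPair, ?_, ?_⟩,
    ⟨⟨1, 1, mem_tensionRegion_otPair, by norm_num⟩, ?_⟩,
    ⟨⟨1, 0, mem_tensionRegion_bitOT, by norm_num⟩, ?_⟩⟩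
  -- Moving diagonally towards the origin in the first two coordinates makes their sum less than 2,
  -- hence leaves the region.
  · refine mem_frontier_of_seq mem_tensionRegion_otPair
      (fun n : ℕ => (1 - 1 / ((n : ℝ) + 1), 1 - 1 / ((n : ℝ) + 1), 0))
      (hlim.prodMk_nhds (hlim.prodMk_nhds tendsto_const_nhds)) fun n hn => ?_
    have := two_le_of_mem_tensionRegion hn
    have := hpos n
    linarith
  · refine mem_frontier_of_seq mem_tensionRegion_otPair
      (fun n : ℕ => (1 - 1 / ((n : ℝ) + 1), 1 - 1 / ((n : ℝ) + 1)))
      (hlim.prodMk_nhds hlim) fun n hn => ?_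
    have := two_le_of_mem_tensionRegion hn
    have := hpos n
    linarith
  · rintro _ ⟨R₁, R₂, h, rfl⟩
    exact two_le_of_mem_tensionRegion h
  · rintro _ ⟨R₁, R₂, h, rfl⟩
    exact one_le_of_mem_tensionRegion h
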